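/- Let $m\ge 0$ be an integer, let $\mathcal H$ be a complex Hilbert space and let $T=(T_1,\dots,T_m)$ be bounded operators on $\mathcal H$, not necessarily commuting; they make $\mathcal H$ a Hilbert module over the algebra $\mathbb F[Z_1,\dots,Z_m]$ of noncommutative polynomials, $p\cdot h=p(T_1,\dots,T_m)h$. Assume that $\mathcal H$ is co-spherically contractive, i.e. $\|\sum_i T_ih_i\|^2\le\sum_i\|h_i\|^2$ for all $h_1,\dots,h_m\in\mathcal H$, and pure, i.e. $P^l(I_{\mathcal H})\to 0$ in the strong operator topology as $l\to\infty$, where $P(A)=\sum_iT_iAT_i^*$. Let $F^2_m=\bigoplus_{k\ge0}(\mathbb C^m)^{\otimes k}$ be the full Fock space, with orthonormal basis $(e_\alpha)$ indexed by the words $\alpha$ in $m$ letters, and let $S_i f=e_i\otimes f$ be the creation operators. For Hilbert spaces $\mathcal E,\mathcal E_*$, a bounded operator $\Theta:F^2_m\otimes\mathcal E\to F^2_m\otimes\mathcal E_*$ is called multi-analytic if $\Theta(S_i\otimes I_{\mathcal E})=(S_i\otimes I_{\mathcal E_*})\Theta$ for $i=1,\dots,m$. A characteristic operator of $\mathcal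 H$ is an isometric multi-analytic operator $\Theta:F^2_m\otimes\mathcal E\to F^2_m\otimes\mathcal E_*$, for some Hilbert spaces $\mathcal E,\mathcal E_*$, such that $\mathcal H$ is isometrically isomorphic, as a module, to the quotient module $(F^2_m\otimes\mathcal E_*)/\Theta(F^2_m\otimes\mathcal E)$. Then: 1. Characteristic operators of $\mathcal H$ exist. More precisely, regard $T$ also as the row operator $\mathcal H^m\to\mathcal H$, and put $\Delta_T=(I-T^*T)^{1/2}$, $\Delta_{T^*}=(I-TT^*)^{1/2}$, $\mathcal D_T=\overline{\Delta_T\mathcal H^m}$ and $\mathcal D_{T^*}=\overline{\Delta_{T^*}\mathcal H}$. Then there is a multi-analytic operator $\Theta_T:F^2_m\otimes\mathcal D_T\to F^2_m\otimes\mathcal D_{T^*}$ (the characteristic function of the row contraction $T$) with $$\Theta_T(1\otimes x)=-1\otimes Tx+\sum_{i=1}^m\sum_{\alpha}e_{i\alpha}\otimes\Delta_{T^*}T_\alpha^*(\Delta_Tx)_i\qquad(x\in\mathcal D_T),$$ where $T_\alpha=T_{i_1}\cdots T_{i_k}$ for $\alpha=i_1\cdots i_k$, and $\Theta_T$ is a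 characteristic operator of $\mathcal H$. 2. For every characteristic operator $\Theta:F^2_m\otimes\mathcal E\to F^2_m\otimes\mathcal E_*$ of $\mathcal H$, the module $\mathcal H$ is similar to $F^2_m\otimes\mathcal F$ for some Hilbert space $\mathcal F$ (that is, there is a bounded invertible operator $X:F^2_m\otimes\mathcal F\to\mathcal H$ with $X(S_i\otimes I_{\mathcal F})=T_iX$ for $i=1,\dots,m$) if and only if $\Theta$ is left invertible, that is, if and only if there is a multi-analytic operator $\Psi:F^2_m\otimes\mathcal E_*\to F^2_m\otimes\mathcal E$ with $\Psi\Theta=I_{F^2_m\otimes\mathcal E}$. -/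

import Mathlib

open Filter Topology

universe u v w

noncomputable section

namespace FockModule

/-- The Hilbert space `F²_m ⊗ E`, where `F²_m = ⨁_k (ℂ^m)^{⊗ k}` is the full Fock space.  The vectors
`e_α = e_{i₁} ⊗ ⋯ ⊗ e_{iₖ}`, indexed by the words `α = i₁ ⋯ iₖ` in `m` letters (the empty word gives the
vacuum vector `1`), form an orthonormal basis of `F²_m`, so that `F²_m ⊗ E` is the space of square
summable families of elements of `E` indexed by words: `f = ∑_α e_α ⊗ f α`. -/
abbrev Fock (m : ℕ) (E : Type*) [NormedAddCommGroup E] : Type _ :=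
  lp (fun _ : List (Fin m) => E) 2

section Shift

variable {m : ℕ} {E : Type*} [NormedAddCommGroup E]

/-- The family `S_i f`: its value at the word `i α` is `f α`, its other values are zero. -/
def shiftFun (i : Fin m) (f : List (Fin m) → E) : List (Fin m) → E
  | [] => 0
  | j :: α => if j = i then f α else 0

theorem shiftFun_cons_self (i : Fin m) (f : List (Fin m) → E) (α : List (Fin m)) :
    shiftFun i f (i :: α) = f α := by
  simp [shiftFun]

theorem cons_injective (i : Fin m) : Function.Injective (fun α : List (Fin m) => i :: α) :=
  fun _ _ h => (List.cons.inj h).2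

theorem shiftFun_eq_zero (i : Fin m) (f : List (Fin m) → E) (α : List (Fin m))
    (h : α ∉ Set.range (fun α : List (Fin m) => i :: α)) : shiftFun i f α = 0 := by
  cases α with
  | nil => rfl
  | cons j α =>
    have hj : j ≠ i := by
      rintro rfl
      exact h ⟨α, rfl⟩
    simp [shiftFun, hj]

theorem hasSum_shiftFun (i : Fin m) (f : Fock m E) :
    HasSum (fun α => ‖shiftFun i f α‖ ^ (2 : ℝ)) (‖f‖ ^ (2 : ℝ)) := by
  have h2 : 0 < (2 : ENNReal).toReal := by norm_num
  have h := lp.hasSum_norm h2 f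
  have e : (2 : ENNReal).toReal = 2 := by norm_num
  rw [e] at h
  refine ((cons_injective i).hasSum_iff ?_).1 ?_
  · intro α hα
    simp [shiftFun_eq_zero i f α hα]
  · simpa [Function.comp_def, shiftFun_cons_self] using h

theorem memℓp_shiftFun (i : Fin m) (f : Fock m E) :
    Memℓp (E := fun _ : List (Fin m) => E) (shiftFun i f) 2 := by
  refine memℓp_gen ?_
  have e : (2 : ENNReal).toReal = 2 := by norm_num
  rw [e]
  exact (hasSum_shiftFun i f).summable

/-- The operator `S_i ⊗ I_E` on `F²_m ⊗ E`, where `S_i f = e_i ⊗ f` is the `i`-th (left) creation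
operator: `e_α ⊗ x` is sent to `e_{iα} ⊗ x`. -/
def creation [InnerProductSpace ℂ E] (i : Fin m) : Fock m E →L[ℂ] Fock m E :=
  LinearMap.mkContinuous
    { toFun := fun f => ⟨shiftFun i f, memℓp_shiftFun i f⟩
      map_add' := by
        intro f g
        ext α
        change shiftFun i (f + g : Fock m E) α = shiftFun i f α + shiftFun i g α
        cases α with
        | nil => simp [shiftFun]
        | cons j α => by_cases h : j = i <;> simp [shiftFun, h]
      map_smul' := by
        intro c f
        ext α
        cases α with
        | nil => simp [shiftFun]
        | cons j α => by_cases h : j = i <;> simp [shiftFun, h] }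
    1 (by
      intro f
      rw [one_mul]
      have h2 : 0 < (2 : ENNReal).toReal := by norm_num
      have e : (2 : ENNReal).toReal = 2 := by norm_num
      have h := lp.hasSum_norm h2
        (⟨shiftFun i f, memℓp_shiftFun i f⟩ : lp (fun _ : List (Fin m) => E) 2)
      rw [e] at h
      have h' := h.unique (hasSum_shiftFun i f)
      exact ((Real.rpow_left_inj (norm_nonneg _) (norm_nonneg _) (by norm_num)).1 h').le)

/-- The vector `1 ⊗ x = e_∅ ⊗ x` of `F²_m ⊗ E`. -/
def vacuum (m : ℕ) (x : E) : Fock m E :=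
  lp.single 2 ([] : List (Fin m)) x

end Shift

section MultiAnalytic

variable {m : ℕ}
variable {E : Type*} [NormedAddCommGroup E] [InnerProductSpace ℂ E]
variable {E' : Type*} [NormedAddCommGroup E'] [InnerProductSpace ℂ E']

/-- `Θ : F²_m ⊗ E → F²_m ⊗ E'` is multi-analytic: `Θ (S_i ⊗ I) = (S_i ⊗ I) Θ` for all `i`. -/
def IsMultiAnalytic (Θ : Fock m E →L[ℂ] Fock m E') : Prop :=
  ∀ i : Fin m, Θ ∘L creation i = creation i ∘L Θ

/-- `Θ` is left invertible: there is a multi-analytic `Ψ` with `Ψ Θ = I`. -/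
def HasMultiAnalyticLeftInverse (Θ : Fock m E →L[ℂ] Fock m E') : Prop :=
  ∃ Ψ : Fock m E' →L[ℂ] Fock m E,
    IsMultiAnalytic Ψ ∧ Ψ ∘L Θ = ContinuousLinearMap.id ℂ (Fock m E)

end MultiAnalytic

/-! A Hilbert module over the algebra of polynomials in `m` noncommuting variables is a Hilbert space
`H` with bounded operators `T 0, …, T (m - 1)`, the polynomial `p` acting as `p(T)`; a linear map
between two of them is a module map if and only if it intertwines the two tuples of operators. -/

section Module

variable {m : ℕ} {H : Type*} [NormedAddCommGroup H] [InnerProductSpace ℂ H]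

/-- The module given by `T` is co-spherically contractive: `T` is a row contraction. -/
def IsRowContraction (T : Fin m → H →L[ℂ] H) : Prop :=
  ∀ h : Fin m → H, ‖∑ i, T i (h i)‖ ^ 2 ≤ ∑ i, ‖h i‖ ^ 2

/-- The module given by `T` is similar to `F²_m ⊗ F`: there is a bounded invertible module map. -/
def IsSimilarToFock (T : Fin m → H →L[ℂ] H) (F : Type*) [NormedAddCommGroup F]
    [InnerProductSpace ℂ F] : Prop :=
  ∃ X : Fock m F ≃L[ℂ] H, ∀ (i : Fin m) (f : Fock m F), X (creation i f) = T i (X f)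

/-- `Θ : F²_m ⊗ E → F²_m ⊗ E'` is a characteristic operator of the module given by `T`: it is an
isometric multi-analytic operator, and the module is isometrically isomorphic to the quotient module
`(F²_m ⊗ E') / Θ (F²_m ⊗ E)` (with the quotient norm and the operators induced by `S_i ⊗ I`). -/
def IsCharacteristicOperator (T : Fin m → H →L[ℂ] H)
    {E : Type*} [NormedAddCommGroup E] [InnerProductSpace ℂ E]
    {E' : Type*} [NormedAddCommGroup E'] [InnerProductSpace ℂ E']
    (Θ : Fock m E →L[ℂ] Fock m E') : Prop :=
  IsMultiAnalytic Θ ∧ Isometry Θ ∧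
    ∃ U : (Fock m E' ⧸ LinearMap.range (Θ : Fock m E →ₗ[ℂ] Fock m E')) ≃ₗᵢ[ℂ] H,
      ∀ (i : Fin m) (f : Fock m E'),
        U (Submodule.Quotient.mk (creation i f)) = T i (U (Submodule.Quotient.mk f))

variable [CompleteSpace H]

/-- The completely positive map `A ↦ ∑ i, T_i A T_i^*`. -/
def cpMap (T : Fin m → H →L[ℂ] H) (A : H →L[ℂ] H) : H →L[ℂ] H :=
  ∑ i, T i ∘L A ∘L ContinuousLinearMap.adjoint (T i)

/-- The module given by `T` is pure: the iterates of `cpMap T` at the identity tend to zero in the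
strong operator topology. -/
def IsPure (T : Fin m → H →L[ℂ] H) : Prop :=
  ∀ h : H, Tendsto (fun l : ℕ => ((cpMap T)^[l] (ContinuousLinearMap.id ℂ H)) h) atTop (𝓝 0)

/-- The row operator `[T_1, …, T_m] : H^m → H`, where `H^m` is the Hilbert direct sum. -/
def rowOp (T : Fin m → H →L[ℂ] H) : PiLp 2 (fun _ : Fin m => H) →L[ℂ] H :=
  ∑ i, T i ∘L PiLp.proj 2 (fun _ : Fin m => H) i

/-- The positive square root of a positive bounded operator `A` on a Hilbert space. -/
def posSqrt {K : Type*} [NormedAddCommGroup K] [InnerProductSpace ℂ K] [CompleteSpace K]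
    (A : K →L[ℂ] K) : K →L[ℂ] K :=
  CFC.sqrt A

/-- The defect operator `Δ_T = (I - T^* T)^{1/2}` on `H^m`, `T` being the row operator. -/
def defect (T : Fin m → H →L[ℂ] H) :
    PiLp 2 (fun _ : Fin m => H) →L[ℂ] PiLp 2 (fun _ : Fin m => H) :=
  posSqrt (1 - ContinuousLinearMap.adjoint (rowOp T) ∘L rowOp T)

/-- The defect operator `Δ_{T^*} = (I - T T^*)^{1/2}` on `H`, `T` being the row operator. -/
def defectStar (T : Fin m → H →L[ℂ] H) : H →L[ℂ] H :=
  posSqrt (1 - rowOp T ∘L ContinuousLinearMap.adjoint (rowOp T))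

/-- The defect space of `T`, the closure of the range of `Δ_T`. -/
abbrev DefectSpace (T : Fin m → H →L[ℂ] H) : Submodule ℂ (PiLp 2 (fun _ : Fin m => H)) :=
  (LinearMap.range
    (defect T : PiLp 2 (fun _ : Fin m => H) →ₗ[ℂ] PiLp 2 (fun _ : Fin m => H))).topologicalClosure

/-- The defect space of `T^*`, the closure of the range of `Δ_{T^*}`. -/
abbrev DefectStarSpace (T : Fin m → H →L[ℂ] H) : Submodule ℂ H :=
  (LinearMap.range (defectStar T : H →ₗ[ℂ] H)).topologicalClosure

/-- For a word `α = i₁ ⋯ iₖ`, the operator `(T_{i₁} ⋯ T_{iₖ})^* = T_{iₖ}^* ⋯ T_{i₁}^*`. -/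
def wordAdjoint (T : Fin m → H →L[ℂ] H) (α : List (Fin m)) : H →L[ℂ] H :=
  ContinuousLinearMap.adjoint (α.map T).prod

/-- The coefficients of `θ x = - 1 ⊗ T x + ∑_{i, α} e_{iα} ⊗ Δ_{T^*} T_α^* (Δ_T x)_i`, the symbol of
the characteristic function of the row contraction `T`. -/
def symbolCoeff (T : Fin m → H →L[ℂ] H) (x : PiLp 2 (fun _ : Fin m => H)) :
    List (Fin m) → H
  | [] => - rowOp T x
  | i :: α => defectStar T (wordAdjoint T α (defect T x i))

/-- `Θ` is the characteristic function
`Θ_T = - I ⊗ T + (I ⊗ Δ_{T^*}) (I - ∑ R_i ⊗ T_i^*)⁻¹ [R_1 ⊗ I, …, R_m ⊗ I] (I ⊗ Δ_T)`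
of `T` (`R_i` the right creation operators): it is the multi-analytic operator between the Fock spaces
over the two defect spaces whose value at `1 ⊗ x` has the coefficients `symbolCoeff T x`. -/
def IsCharacteristicFunction (T : Fin m → H →L[ℂ] H)
    (Θ : Fock m (DefectSpace T) →L[ℂ] Fock m (DefectStarSpace T)) : Prop :=
  IsMultiAnalytic Θ ∧
    ∀ (x : DefectSpace T) (α : List (Fin m)),
      ((Θ (vacuum m x) α : DefectStarSpace T) : H) = symbolCoeff T (x : PiLp 2 (fun _ : Fin m => H)) α

end Module

end FockModule

end

/-!
Everything rests on the splitting `f = 1 ⊗ f_∅ + ∑ i, S_i (S_i^* f)` of a vector of a Fock module, which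
turns statements about all words into recursions on the first letter, and on the summation of a
contractive one-step relation along all words (`sum_words_responseCoeff_le`).

*The characteristic function.*  For a pure row contraction the Poisson kernel
`K h = ∑ e_α ⊗ Δ_{T^*} T_α^* h` is isometric, because the sum of `‖Δ_{T^*} T_α^* h‖²` over the words of
length less than `n` telescopes to `‖h‖² - ⟨P^n(I) h, h⟩` (`exists_poissonKernel`).  Its adjoint is a
coisometric module map onto `H`, so it suffices that the characteristic function is an isometry onto
`ker K^*` (`isCharacteristicOperator_of_coisometry`).  Its symbol is
`θ x = - 1 ⊗ T x + ∑ i, S_i K (Δ_T x)_i`, and `T Δ_T = Δ_{T^*} T` gives `K^* θ = 0`, so that the range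
of `θ` is a wandering subspace and `θ` extends to an isometric module map
(`IsRowIsometry.exists_isometry`).  A vector of `ker K^*` orthogonal to the range of this extension has
zero coefficients, by unitarity of the Julia operator of `T`.

*Similarity implies left invertibility.*  Let `π` be the quotient map onto `H` and `X` a similarity from
a Fock module onto `H`.  Commutant lifting gives a multi-analytic `Y` with `π Y = X`
(`exists_lift`); then `J = Y X⁻¹ π` is an idempotent module map, `1 - J` maps onto the range of `Θ`,
and `Ψ = Θ^* (1 - J)` is a left inverse.  The lifting is obtained as the transfer operator of a
contractive system: with `Γ = (1 - X X^*)^{1/2}`, the operators `[π|_{1 ⊗ G}, T_1 Γ, …, T_m Γ]` and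
`[X|_{1 ⊗ F}, Γ]` satisfy `R R^* = Q Q^*`, so Douglas' lemma provides the system
(`exists_contractiveSystem`).  Purity makes the difference between `π Y` and `X` vanish
(`eq_zero_of_recursion`).

*Left invertibility implies similarity.*  If `Ψ Θ = 1`, then `π` restricts to an isomorphism of
`ker Ψ` onto `H`.  The inverse embeds `H` in a Fock module; renorming `H` by the absolute value of this
embedding makes it isometric, and the Wold decomposition (`exists_fock_equiv_of_isometry`) identifies
`H` with the Fock module over a subspace of `H` itself.
-/

noncomputable section

namespace FockModule

/-! ### The Fock space: backward shifts and words -/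

section Fock

variable {m : ℕ} {E : Type*} [NormedAddCommGroup E]

@[simp]
theorem vacuum_nil (x : E) : vacuum m x [] = x :=
  lp.single_apply_self (E := fun _ : List (Fin m) => E) 2 [] x

@[simp]
theorem vacuum_cons (x : E) (i : Fin m) (α : List (Fin m)) : vacuum m x (i :: α) = 0 :=
  lp.single_apply_ne (E := fun _ : List (Fin m) => E) 2 [] x (by simp)

/-- The words of length less than `n`. -/
def words (m : ℕ) : ℕ → Finset (List (Fin m))
  | 0 => ∅
  | n + 1 => insert [] (Finset.univ.biUnion fun i =>
      (words m n).map ⟨fun α => i :: α, cons_injective i⟩)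

theorem mem_words {n : ℕ} {α : List (Fin m)} : α ∈ words m n ↔ α.length < n := by
  induction n generalizing α with
  | zero => simp [words]
  | succ n ih =>
    cases α with
    | nil => simp [words]
    | cons i α => simp [words, ih]

theorem sum_words_succ (n : ℕ) (g : List (Fin m) → ℝ) :
    ∑ α ∈ words m (n + 1), g α = g [] + ∑ i, ∑ α ∈ words m n, g (i :: α) := by
  rw [words, Finset.sum_insert (by simp), Finset.sum_biUnion]
  · simp
  · intro i _ j _ hij
    simp only [Function.onFun, Finset.disjoint_left, Finset.mem_map, Function.Embedding.coeFn_mk]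
    rintro _ ⟨α, _, rfl⟩ ⟨β, _, h⟩
    exact hij (List.cons.inj h).1.symm

theorem exists_subset_words (s : Finset (List (Fin m))) : ∃ n, s ⊆ words m n :=
  ⟨s.sup List.length + 1, fun _ hα =>
    mem_words.2 (Nat.lt_succ_of_le (Finset.le_sup (f := List.length) hα))⟩

@[simp]
theorem norm_vacuum (x : E) : ‖vacuum m x‖ = ‖x‖ :=
  lp.norm_single (E := fun _ : List (Fin m) => E) (by norm_num) [] x

theorem sum_words_le_norm_sq (f : Fock m E) (n : ℕ) : ∑ α ∈ words m n, ‖f α‖ ^ 2 ≤ ‖f‖ ^ 2 := by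
  have h := lp.sum_rpow_le_norm_rpow (p := 2) (by norm_num) f (words m n)
  simpa using h

theorem sum_le_of_forall_words {g : List (Fin m) → E} {C : ℝ}
    (h : ∀ n, ∑ α ∈ words m n, ‖g α‖ ^ 2 ≤ C) (s : Finset (List (Fin m))) :
    ∑ α ∈ s, ‖g α‖ ^ (2 : ENNReal).toReal ≤ C := by
  obtain ⟨n, hn⟩ := exists_subset_words s
  have := (Finset.sum_le_sum_of_subset_of_nonneg hn
    (f := fun α => ‖g α‖ ^ 2) fun _ _ _ => by positivity).trans (h n)
  simpa using this

variable [InnerProductSpace ℂ E]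

@[simp]
theorem creation_nil (i : Fin m) (f : Fock m E) : creation i f [] = 0 := rfl

theorem creation_cons (i j : Fin m) (f : Fock m E) (α : List (Fin m)) :
    creation i f (j :: α) = if j = i then f α else 0 := rfl

/-- The backward shift `(S_i ⊗ I)^*`, whose value at the word `α` is the value at `i α`. -/
def backward (i : Fin m) : Fock m E →ₗ[ℂ] Fock m E where
  toFun f := ⟨fun α => f (i :: α), by
    refine memℓp_gen ?_
    exact ((lp.memℓp f).summable (by norm_num)).comp_injective (cons_injective i)⟩
  map_add' _ _ := rfl
  map_smul' _ _ := rfl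

@[simp]
theorem backward_apply (i : Fin m) (f : Fock m E) (α : List (Fin m)) :
    backward i f α = f (i :: α) := rfl

theorem backward_creation (i j : Fin m) (f : Fock m E) :
    backward j (creation i f) = if j = i then f else 0 := by
  ext α
  rw [backward_apply, creation_cons]
  split_ifs <;> rfl

@[simp]
theorem backward_vacuum (i : Fin m) (x : E) : backward i (vacuum m x) = 0 := by
  ext α
  simp

/-- Every vector splits as `f = 1 ⊗ f_∅ + ∑ i, S_i S_i^* f`. -/
theorem eq_vacuum_add_sum_creation (f : Fock m E) :
    f = vacuum m (f []) + ∑ i, creation i (backward i f) := by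
  ext α
  rw [lp.coeFn_add, Pi.add_apply, lp.coeFn_sum, Finset.sum_apply]
  cases α with
  | nil => simp
  | cons j α => simp [creation_cons]

theorem inner_vacuum (x : E) (f : Fock m E) : inner ℂ (vacuum m x) f = inner ℂ x (f []) :=
  lp.inner_single_left (G := fun _ : List (Fin m) => E) [] x f

theorem inner_creation (i : Fin m) (f g : Fock m E) :
    inner ℂ (creation i f) g = inner ℂ f (backward i g) := by
  have h := lp.hasSum_inner (𝕜 := ℂ) f (backward i g)
  refine (lp.hasSum_inner (𝕜 := ℂ) (creation i f) g).unique
    (((cons_injective i).hasSum_iff ?_).1 ?_)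
  · intro α hα
    have : creation i f α = 0 := shiftFun_eq_zero i f α hα
    simp [this]
  · convert h using 2 with α
    simp [creation_cons]

theorem inner_backward (i : Fin m) (f g : Fock m E) :
    inner ℂ (backward i f) g = inner ℂ f (creation i g) := by
  rw [← inner_conj_symm, ← inner_creation, inner_conj_symm]

theorem inner_vacuum_right (x : E) (f : Fock m E) : inner ℂ f (vacuum m x) = inner ℂ (f []) x := by
  rw [← inner_conj_symm, inner_vacuum, inner_conj_symm]

theorem inner_creation_creation (i j : Fin m) (f g : Fock m E) :
    inner ℂ (creation i f) (creation j g) = if i = j then inner ℂ f g else 0 := by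
  rw [inner_creation, backward_creation]
  split_ifs <;> simp

theorem inner_eq_add_sum (f g : Fock m E) :
    inner ℂ f g = inner ℂ (f []) (g []) + ∑ i, inner ℂ (backward i f) (backward i g) := by
  conv_lhs => rw [eq_vacuum_add_sum_creation f]
  rw [inner_add_left, sum_inner, inner_vacuum]
  simp only [inner_creation]

theorem norm_sq_eq_add_sum (f : Fock m E) :
    ‖f‖ ^ 2 = ‖f []‖ ^ 2 + ∑ i, ‖backward i f‖ ^ 2 := by
  have h := congrArg Complex.re (inner_eq_add_sum f f)
  simpa [inner_self_eq_norm_sq_to_K, ← Complex.ofReal_pow] using h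

/-- The vacuum embedding `x ↦ 1 ⊗ x` as a linear isometry. -/
def vacuumₗᵢ (m : ℕ) (E : Type*) [NormedAddCommGroup E] [InnerProductSpace ℂ E] :
    E →ₗᵢ[ℂ] Fock m E where
  toFun := vacuum m
  map_add' x y := lp.single_add (E := fun _ : List (Fin m) => E) 2 [] x y
  map_smul' c x := lp.single_smul (E := fun _ : List (Fin m) => E) 2 [] c x
  norm_map' := norm_vacuum

@[simp]
theorem vacuumₗᵢ_apply (x : E) : vacuumₗᵢ m E x = vacuum m x := rfl

end Fock

/-! ### Contractive systems and their responses -/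

section System

variable {m : ℕ}
variable {E : Type*} [NormedAddCommGroup E] [InnerProductSpace ℂ E]
variable {E' : Type*} [NormedAddCommGroup E'] [InnerProductSpace ℂ E']
variable {K : Type*} [NormedAddCommGroup K] [InnerProductSpace ℂ K]

/-- A system with input space `E`, state space `K` and output space `E'` turns an input `v` and a state
`h` into the output `p (v, h)` and, for each letter `i`, the next state `q i (v, h)`.  It is contractive
if the column operator `(p, q)` is a contraction for the Hilbert norms of the direct sums. -/
def IsContractiveSystem (p : E × K →ₗ[ℂ] E') (q : Fin m → E × K →ₗ[ℂ] K) : Prop :=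
  ∀ v h, ‖p (v, h)‖ ^ 2 + ∑ i, ‖q i (v, h)‖ ^ 2 ≤ ‖v‖ ^ 2 + ‖h‖ ^ 2

/-- The output at the word `α` of the system started in the state `h` with the input `f`: the letters
of `α` are read from the left, and the input read after the prefix `β` of `α` is `f β`. -/
def responseCoeff (p : E × K →ₗ[ℂ] E') (q : Fin m → E × K →ₗ[ℂ] K) :
    List (Fin m) → K → Fock m E → E'
  | [], h, f => p (f [], h)
  | i :: α, h, f => responseCoeff p q α (q i (f [], h)) (backward i f)

variable {p : E × K →ₗ[ℂ] E'} {q : Fin m → E × K →ₗ[ℂ] K}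

theorem responseCoeff_add (α : List (Fin m)) (h k : K) (f g : Fock m E) :
    responseCoeff p q α (h + k) (f + g) = responseCoeff p q α h f + responseCoeff p q α k g := by
  induction α generalizing h k f g with
  | nil => exact p.map_add (f [], h) (g [], k)
  | cons i α ih =>
    have hq : q i ((f + g) [], h + k) = q i (f [], h) + q i (g [], k) :=
      (q i).map_add (f [], h) (g [], k)
    rw [responseCoeff, hq, map_add, ih]
    rfl

theorem responseCoeff_smul (α : List (Fin m)) (c : ℂ) (h : K) (f : Fock m E) :
    responseCoeff p q α (c • h) (c • f) = c • responseCoeff p q α h f := by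
  induction α generalizing h f with
  | nil => exact p.map_smul c (f [], h)
  | cons i α ih =>
    have hq : q i ((c • f) [], c • h) = c • q i (f [], h) := (q i).map_smul c (f [], h)
    rw [responseCoeff, hq, map_smul, ih]
    rfl

theorem sum_words_responseCoeff_le (hpq : IsContractiveSystem p q) (n : ℕ) (h : K) (f : Fock m E) :
    ∑ α ∈ words m n, ‖responseCoeff p q α h f‖ ^ 2 ≤ ‖h‖ ^ 2 + ‖f‖ ^ 2 := by
  induction n generalizing h f with
  | zero => simpa [words] using by positivity
  | succ n ih =>
    rw [sum_words_succ]
    have h1 := Finset.sum_le_sum fun i (_ : i ∈ Finset.univ) => ih (q i (f [], h)) (backward i f)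
    rw [Finset.sum_add_distrib] at h1
    have h2 := hpq (f []) h
    have h3 := norm_sq_eq_add_sum f
    simp only [responseCoeff]
    linarith

/-- The response of a contractive system, as a function of the initial state and of the input. -/
def response (hpq : IsContractiveSystem p q) : K × Fock m E →ₗ[ℂ] Fock m E' where
  toFun z := ⟨fun α => responseCoeff p q α z.1 z.2,
    memℓp_gen' (sum_le_of_forall_words fun n => sum_words_responseCoeff_le hpq n z.1 z.2)⟩
  map_add' y z := by
    ext α
    exact responseCoeff_add α y.1 z.1 y.2 z.2
  map_smul' c z := by
    ext α
    exact responseCoeff_smul α c z.1 z.2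

theorem response_nil (hpq : IsContractiveSystem p q) (h : K) (f : Fock m E) :
    response hpq (h, f) [] = p (f [], h) := rfl

theorem backward_response (hpq : IsContractiveSystem p q) (i : Fin m) (h : K) (f : Fock m E) :
    backward i (response hpq (h, f)) = response hpq (q i (f [], h), backward i f) := rfl

theorem norm_response_sq_le (hpq : IsContractiveSystem p q) (h : K) (f : Fock m E) :
    ‖response hpq (h, f)‖ ^ 2 ≤ ‖h‖ ^ 2 + ‖f‖ ^ 2 := by
  have h0 : 0 ≤ ‖h‖ ^ 2 + ‖f‖ ^ 2 := by positivity
  have := lp.norm_le_of_forall_sum_le (p := 2) (by norm_num) (Real.sqrt_nonneg _)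
    (f := response hpq (h, f)) (C := √(‖h‖ ^ 2 + ‖f‖ ^ 2)) fun s => by
      refine (sum_le_of_forall_words (fun n => sum_words_responseCoeff_le hpq n h f) s).trans ?_
      simp [Real.sq_sqrt h0]
  exact (Real.le_sqrt (norm_nonneg _) h0).1 this

/-- The response to the zero input, as a function of the initial state. -/
def observability (hpq : IsContractiveSystem p q) : K →L[ℂ] Fock m E' :=
  (response hpq ∘ₗ LinearMap.inl ℂ K (Fock m E)).mkContinuous 1 fun h => by
    have := norm_response_sq_le hpq h 0
    rw [one_mul]
    refine le_of_sq_le_sq ?_ (norm_nonneg _)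
    simpa using this

theorem norm_observability_le (hpq : IsContractiveSystem p q) (h : K) :
    ‖observability hpq h‖ ≤ ‖h‖ := by
  refine le_of_sq_le_sq ?_ (norm_nonneg _)
  change ‖response hpq (h, 0)‖ ^ 2 ≤ ‖h‖ ^ 2
  simpa using norm_response_sq_le hpq h 0

/-- The response of the system at rest, as a function of the input. -/
def transfer (hpq : IsContractiveSystem p q) : Fock m E →L[ℂ] Fock m E' :=
  (response hpq ∘ₗ LinearMap.inr ℂ K (Fock m E)).mkContinuous 1 fun f => by
    have := norm_response_sq_le hpq 0 f
    rw [one_mul]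
    refine le_of_sq_le_sq ?_ (norm_nonneg _)
    simpa using this

theorem transfer_apply (hpq : IsContractiveSystem p q) (f : Fock m E) :
    transfer hpq f = response hpq (0, f) := rfl

theorem isMultiAnalytic_transfer (hpq : IsContractiveSystem p q) :
    IsMultiAnalytic (transfer hpq) := by
  intro i
  ext f α
  have h0 (α : List (Fin m)) : responseCoeff p q α 0 0 = 0 := by
    simpa using responseCoeff_smul (p := p) (q := q) α 0 0 0
  change responseCoeff p q α 0 (creation i f) = creation i (transfer hpq f) α
  cases α with
  | nil => exact h0 []
  | cons j α =>
    rw [creation_cons, responseCoeff, creation_nil, backward_creation]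
    rw [show ((0 : E), (0 : K)) = 0 from rfl, map_zero]
    split_ifs
    · rfl
    · exact h0 α

end System

/-! ### Wandering subspaces and the Wold decomposition -/

section Wandering

variable {m : ℕ}
variable {E : Type*} [NormedAddCommGroup E] [InnerProductSpace ℂ E]
variable {K : Type*} [NormedAddCommGroup K] [InnerProductSpace ℂ K]

/-- The operators `A_i` are isometries with pairwise orthogonal ranges. -/
def IsRowIsometry (A : Fin m → K →L[ℂ] K) : Prop :=
  ∀ i j h k, inner ℂ (A i h) (A j k) = if i = j then inner ℂ h k else 0

variable {A : Fin m → K →L[ℂ] K}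

theorem isRowIsometry_creation : IsRowIsometry (creation (m := m) (E := E)) :=
  inner_creation_creation

theorem IsRowIsometry.norm_apply (hA : IsRowIsometry A) (i : Fin m) (h : K) : ‖A i h‖ = ‖h‖ := by
  have e := congrArg Complex.re (hA i i h h)
  rw [← sq_eq_sq₀ (norm_nonneg _) (norm_nonneg _)]
  simpa [inner_self_eq_norm_sq_to_K, ← Complex.ofReal_pow] using e

theorem IsRowIsometry.norm_prod_apply (hA : IsRowIsometry A) (α : List (Fin m)) (h : K) :
    ‖(α.map A).prod h‖ = ‖h‖ := by
  induction α with
  | nil => simp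
  | cons i α ih => simp [hA.norm_apply, ih]

theorem IsRowIsometry.orthogonalFamily (hA : IsRowIsometry A) (θ : E →ₗᵢ[ℂ] K)
    (hθ : ∀ x y i (α : List (Fin m)), inner ℂ (θ x) (A i ((α.map A).prod (θ y))) = 0) :
    OrthogonalFamily ℂ (fun _ : List (Fin m) => E) fun α : List (Fin m) =>
      ⟨((α.map A).prod : K →ₗ[ℂ] K) ∘ₗ θ.toLinearMap, fun x => by
        simpa using hA.norm_prod_apply α (θ x)⟩ := by
  intro α β hαβ x y
  change inner ℂ ((α.map A).prod (θ x)) ((β.map A).prod (θ y)) = 0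
  induction α generalizing β with
  | nil =>
    cases β with
    | nil => exact absurd rfl hαβ
    | cons j β => simpa using hθ x y j β
  | cons i α ih =>
    cases β with
    | nil =>
      rw [inner_eq_zero_symm]
      simpa using hθ y x i α
    | cons j β =>
      simp only [List.map_cons, List.prod_cons, mul_apply_eq_comp, hA i j]
      split_ifs with hij
      · exact ih fun h => hαβ (by rw [hij, h])
      · rfl

/-- An isometry `θ` onto a wandering subspace of a row isometry `A` extends to an isometric module map
`e_α ⊗ x ↦ A_α (θ x)`. -/
theorem IsRowIsometry.exists_isometry [CompleteSpace K] (hA : IsRowIsometry A) (θ : E →ₗᵢ[ℂ] K)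
    (hθ : ∀ x y i (α : List (Fin m)), inner ℂ (θ x) (A i ((α.map A).prod (θ y))) = 0) :
    ∃ Θ : Fock m E →ₗᵢ[ℂ] K, (∀ x, Θ (vacuum m x) = θ x) ∧
      ∀ i f, Θ (creation i f) = A i (Θ f) := by
  have hV := hA.orthogonalFamily θ hθ
  refine ⟨hV.linearIsometry, fun x => (hV.linearIsometry_apply_single x).trans ?_, fun i f => ?_⟩
  · simp
  · have h1 := hV.hasSum_linearIsometry (creation i f)
    have h2 := (hV.hasSum_linearIsometry f).mapL (A i)
    refine h1.unique (((cons_injective i).hasSum_iff ?_).1 ?_)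
    · intro α hα
      have : creation i f α = 0 := shiftFun_eq_zero i f α hα
      simp [this]
    · convert h2 using 2 with α
      simp [creation_cons]

theorem surjective_of_orthogonal_eq_zero [CompleteSpace E] [CompleteSpace K]
    {Θ : Fock m E →ₗᵢ[ℂ] K}
    (h : ∀ k, (∀ f, inner ℂ (Θ f) k = 0) → k = 0) : Function.Surjective Θ := by
  have hc : IsClosed (LinearMap.range Θ.toLinearMap : Set K) := by
    convert Θ.isometry.isClosedEmbedding.isClosed_range
    ext; simp
  have : CompleteSpace (LinearMap.range Θ.toLinearMap) := hc.completeSpace_coe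
  rw [← LinearIsometry.coe_toLinearMap, ← LinearMap.range_eq_top,
    ← Submodule.orthogonal_eq_bot_iff, Submodule.eq_bot_iff]
  exact fun k hk => h k fun f => hk _ ⟨f, rfl⟩

/-- Wold decomposition: a Hilbert module embedded isometrically in a Fock module is a Fock module.
The multiplicity space is the wandering subspace `⋂ i, ker A_i^*`.  Purity comes from the embedding:
a vector orthogonal to all `A_α F` lies in `⋂ n, ⨆ |α| = n, range A_α`, so that all Fock coefficients
of its image vanish. -/
theorem exists_fock_equiv_of_isometry {G : Type*} [NormedAddCommGroup G] [InnerProductSpace ℂ G]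
    {K : Type u} [NormedAddCommGroup K] [InnerProductSpace ℂ K] [CompleteSpace K]
    {A : Fin m → K →L[ℂ] K} (V : K →ₗᵢ[ℂ] Fock m G)
    (hV : ∀ i k, V (A i k) = creation i (V k)) :
    ∃ (F : Type u) (_ : NormedAddCommGroup F) (_ : InnerProductSpace ℂ F) (_ : CompleteSpace F)
      (U : Fock m F ≃ₗᵢ[ℂ] K), ∀ i f, U (creation i f) = A i (U f) := by
  have hA : IsRowIsometry A := fun i j h k => by
    rw [← V.inner_map_map, hV, hV, inner_creation_creation, V.inner_map_map]
  let F : Submodule ℂ K := ⨅ i, LinearMap.ker (ContinuousLinearMap.adjoint (A i) : K →ₗ[ℂ] K)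
  have hF (x : K) : x ∈ F ↔ ∀ i, ContinuousLinearMap.adjoint (A i) x = 0 := by
    simp [F, Submodule.mem_iInf]
  have hc : IsClosed (F : Set K) := by
    have : (F : Set K) = ⋂ i, (ContinuousLinearMap.adjoint (A i)) ⁻¹' {0} := by
      ext x
      simp [hF]
    rw [this]
    exact isClosed_iInter fun i => isClosed_singleton.preimage (ContinuousLinearMap.continuous _)
  have : CompleteSpace F := hc.completeSpace_coe
  obtain ⟨Θ, hΘ0, hΘ⟩ := hA.exists_isometry F.subtypeₗᵢ fun x y i α => by
    rw [← ContinuousLinearMap.adjoint_inner_left]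
    simp [(hF x).1 x.2 i]
  -- Vectors orthogonal to the range are recovered from their images under the `A_i^*`.
  have key (k : K) (hk : ∀ f, inner ℂ (Θ f) k = 0) :
      k = ∑ i, A i (ContinuousLinearMap.adjoint (A i) k) := by
    set r := k - ∑ i, A i (ContinuousLinearMap.adjoint (A i) k) with hr
    have hadj (i j : Fin m) (x : K) :
        ContinuousLinearMap.adjoint (A i) (A j x) = if i = j then x else 0 :=
      ext_inner_left ℂ fun v => by
        rw [ContinuousLinearMap.adjoint_inner_right, hA]
        split_ifs <;> simp
    have hrF : r ∈ F := (hF r).2 fun i => by simp [hr, hadj]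
    have h1 : inner ℂ r k = 0 := by
      have := hk (vacuum m ⟨r, hrF⟩)
      rwa [hΘ0] at this
    have h2 (i : Fin m) : inner ℂ r (A i (ContinuousLinearMap.adjoint (A i) k)) = 0 := by
      rw [← ContinuousLinearMap.adjoint_inner_left, (hF r).1 hrF i, inner_zero_left]
    have h3 : inner ℂ r r = 0 := by
      conv_lhs => rw [hr, inner_sub_right, inner_sum]
      simp [← hr, h1, h2]
    rw [inner_self_eq_zero] at h3
    exact sub_eq_zero.1 h3
  have coeff (α : List (Fin m)) (k : K) (hk : ∀ f, inner ℂ (Θ f) k = 0) : V k α = 0 := by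
    induction α generalizing k with
    | nil =>
      rw [key k hk, map_sum, lp.coeFn_sum, Finset.sum_apply]
      simp [hV]
    | cons i α ih =>
      rw [key k hk, map_sum, lp.coeFn_sum, Finset.sum_apply]
      simp only [hV, creation_cons, Finset.sum_ite_eq, Finset.mem_univ, if_true]
      refine ih _ fun f => ?_
      rw [ContinuousLinearMap.adjoint_inner_right, ← hΘ, hk]
  have hsurj : Function.Surjective Θ := surjective_of_orthogonal_eq_zero fun k hk => by
    have : V k = 0 := by
      ext α
      exact coeff α k hk
    exact V.injective (this.trans (map_zero V).symm)
  exact ⟨F, inferInstance, inferInstance, inferInstance, LinearIsometryEquiv.ofSurjective Θ hsurj,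
    hΘ⟩

end Wandering

/-! ### Operators between Hilbert spaces -/

section Operator

variable {H : Type*} [NormedAddCommGroup H] [InnerProductSpace ℂ H] [CompleteSpace H]
variable {K : Type*} [NormedAddCommGroup K] [InnerProductSpace ℂ K] [CompleteSpace K]
variable {L : Type*} [NormedAddCommGroup L] [InnerProductSpace ℂ L] [CompleteSpace L]

open ContinuousLinearMap

theorem one_sub_adjoint_comp_self_nonneg {A : H →L[ℂ] K} (hA : ∀ x, ‖A x‖ ≤ ‖x‖) :
    0 ≤ 1 - adjoint A ∘L A := by
  rw [nonneg_iff_isPositive, isPositive_def']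
  refine ⟨(IsSelfAdjoint.one _).sub (isPositive_adjoint_comp_self A).isSelfAdjoint, fun x => ?_⟩
  have h : (1 - adjoint A ∘L A).reApplyInnerSelf x = ‖x‖ ^ 2 - ‖A x‖ ^ 2 := by
    rw [reApplyInnerSelf_apply, sub_apply, inner_sub_left, comp_apply, adjoint_inner_left]
    simp [inner_self_eq_norm_sq_to_K, ← Complex.ofReal_pow]
  rw [h, sub_nonneg]
  exact pow_le_pow_left₀ (norm_nonneg _) (hA x) 2

theorem norm_adjoint_apply_le {A : H →L[ℂ] K} (hA : ∀ x, ‖A x‖ ≤ ‖x‖) (y : K) :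
    ‖adjoint A y‖ ≤ ‖y‖ := by
  have : ‖adjoint A‖ ≤ 1 := by
    rw [LinearIsometryEquiv.norm_map]
    exact A.opNorm_le_bound zero_le_one fun x => by simpa using hA x
  simpa using (adjoint A).le_of_opNorm_le this y

theorem isSelfAdjoint_posSqrt (A : K →L[ℂ] K) : IsSelfAdjoint (posSqrt A) :=
  (CFC.sqrt_nonneg A).isSelfAdjoint

theorem posSqrt_mul_self {A : K →L[ℂ] K} (hA : 0 ≤ A) : posSqrt A * posSqrt A = A :=
  CFC.sqrt_mul_sqrt_self A hA

theorem inner_posSqrt_left (A : K →L[ℂ] K) (x y : K) :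
    inner ℂ (posSqrt A x) y = inner ℂ x (posSqrt A y) := by
  conv_lhs => rw [← (isSelfAdjoint_posSqrt A).adjoint_eq, adjoint_inner_left]

theorem posSqrt_posSqrt_apply {A : H →L[ℂ] K} (hA : ∀ x, ‖A x‖ ≤ ‖x‖) (x : H) :
    posSqrt (1 - adjoint A ∘L A) (posSqrt (1 - adjoint A ∘L A) x) = x - adjoint A (A x) := by
  rw [← mul_apply_eq_comp, posSqrt_mul_self (one_sub_adjoint_comp_self_nonneg hA)]
  simp

theorem norm_posSqrt_apply_sq {A : H →L[ℂ] K} (hA : ∀ x, ‖A x‖ ≤ ‖x‖) (x : H) :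
    ‖posSqrt (1 - adjoint A ∘L A) x‖ ^ 2 = ‖x‖ ^ 2 - ‖A x‖ ^ 2 := by
  have h : inner ℂ (posSqrt (1 - adjoint A ∘L A) x) (posSqrt (1 - adjoint A ∘L A) x)
      = inner ℂ x x - inner ℂ (A x) (A x) := by
    rw [inner_posSqrt_left, posSqrt_posSqrt_apply hA, inner_sub_right, adjoint_inner_right]
  have := congrArg Complex.re h
  simpa [inner_self_eq_norm_sq_to_K, ← Complex.ofReal_pow] using this

/-- If `A` intertwines two positive operators, it intertwines their square roots.  For
`Z = A a - b A`, where `a`, `b` are the square roots, `b Z = - Z a`; hence `Z^* Z a = - Z^* b Z`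
is both positive, as a product of commuting positive operators, and negative. -/
theorem comp_posSqrt_eq_posSqrt_comp {A : H →L[ℂ] K} {P : H →L[ℂ] H} {Q : K →L[ℂ] K} (hP : 0 ≤ P)
    (hQ : 0 ≤ Q) (h : A ∘L P = Q ∘L A) : A ∘L posSqrt P = posSqrt Q ∘L A := by
  set a := posSqrt P with ha
  set b := posSqrt Q with hb
  have ha0 : 0 ≤ a := CFC.sqrt_nonneg P
  have hb0 : 0 ≤ b := CFC.sqrt_nonneg Q
  have hb' : adjoint b = b := hb0.isSelfAdjoint.adjoint_eq
  have haa : a ∘L a = P := posSqrt_mul_self hP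
  have hbb : b ∘L b = Q := posSqrt_mul_self hQ
  set Z := A ∘L a - b ∘L A with hZ
  have h1 : b ∘L Z = -(Z ∘L a) := by
    rw [hZ, comp_sub, sub_comp, ← comp_assoc b b, hbb, comp_assoc A, haa, h, comp_assoc]
    abel
  have hN : 0 ≤ adjoint Z ∘L b ∘L Z :=
    (nonneg_iff_isPositive _).2 (((nonneg_iff_isPositive _).1 hb0).adjoint_conj Z)
  have hM : 0 ≤ adjoint Z ∘L Z := (nonneg_iff_isPositive _).2 (isPositive_adjoint_comp_self Z)
  have h2 : (adjoint Z ∘L Z) * a = -(adjoint Z ∘L b ∘L Z) := by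
    rw [h1, comp_neg, neg_neg]
    rfl
  have h3 : Commute (adjoint Z ∘L Z) a := by
    have hs : IsSelfAdjoint ((adjoint Z ∘L Z) * a) := h2 ▸ hN.isSelfAdjoint.neg
    have := hs.star_eq
    rw [star_mul, ha0.isSelfAdjoint.star_eq, hM.isSelfAdjoint.star_eq] at this
    exact this.symm
  have h4 : adjoint Z ∘L b ∘L Z = 0 := by
    refine le_antisymm ?_ hN
    have := h3.mul_nonneg hM ha0
    rw [h2] at this
    exact neg_nonneg.1 this
  have h5 : b ∘L Z = 0 := by
    set c := posSqrt b
    have hcc : c ∘L c = b := posSqrt_mul_self hb0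
    have hcZ : c ∘L Z = 0 := by
      rw [← adjoint_comp_self_eq_zero_iff, adjoint_comp, (isSelfAdjoint_posSqrt b).adjoint_eq,
        comp_assoc, ← comp_assoc c c, hcc, h4]
    rw [← hcc, comp_assoc, hcZ, comp_zero]
  have h6 : Z ∘L a = 0 := by rw [← neg_eq_zero, ← h1, h5]
  have h7 : adjoint Z ∘L Z = a ∘L adjoint A ∘L Z := by
    have : adjoint Z = a ∘L adjoint A - adjoint A ∘L b := by
      rw [hZ, map_sub, adjoint_comp, adjoint_comp, hb', ha0.isSelfAdjoint.adjoint_eq]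
    rw [this, sub_comp, comp_assoc, comp_assoc, h5, comp_zero, sub_zero]
  have h8 : adjoint Z ∘L Z = 0 := by
    rw [← adjoint_comp_self_eq_zero_iff, hM.isSelfAdjoint.adjoint_eq]
    nth_rw 2 [h7]
    rw [comp_assoc, ← comp_assoc Z a, h6, zero_comp, comp_zero]
  exact sub_eq_zero.1 (adjoint_comp_self_eq_zero_iff.1 h8)

/-- Douglas' lemma: an operator dominated by `R` factors through `R` by a contraction. -/
theorem exists_comp_eq_of_norm_le {H : Type*} [NormedAddCommGroup H] [InnerProductSpace ℂ H]
    {R : H →L[ℂ] K} {Q : H →L[ℂ] L} (h : ∀ x, ‖Q x‖ ≤ ‖R x‖) :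
    ∃ W : K →L[ℂ] L, (∀ y, ‖W y‖ ≤ ‖y‖) ∧ ∀ x, W (R x) = Q x := by
  let M : Submodule ℂ K := (LinearMap.range (R : H →ₗ[ℂ] K)).topologicalClosure
  let e : H →ₗ[ℂ] M := (R : H →ₗ[ℂ] K).codRestrict M fun x =>
    Submodule.le_topologicalClosure _ ⟨x, rfl⟩
  have he : DenseRange e := by
    rw [DenseRange, Subtype.dense_iff]
    intro y hy
    refine closure_mono ?_ hy
    rintro _ ⟨x, rfl⟩
    exact ⟨e x, ⟨x, rfl⟩, rfl⟩
  have hn (x : H) : ‖(Q : H →ₗ[ℂ] L) x‖ ≤ 1 * ‖e x‖ := by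
    rw [one_mul]
    exact h x
  refine ⟨(Q : H →ₗ[ℂ] L).extendOfNorm e ∘L M.orthogonalProjectionOnto, fun y => ?_, fun x => ?_⟩
  · refine (LinearMap.norm_extendOfNorm_apply_le he 1 hn _).trans ?_
    rw [one_mul]
    exact M.norm_orthogonalProjectionOnto_apply_le y
  · have : M.orthogonalProjectionOnto (R x) = e x :=
      M.orthogonalProjectionOnto_mem_subspace_eq_self (e x)
    rw [comp_apply, this, LinearMap.extendOfNorm_eq he ⟨1, hn⟩]
    rfl

/-- An operator bounded below becomes isometric after composition with an invertible operator, the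
inverse of its absolute value. -/
theorem exists_equiv_norm_comp_eq {R : H →L[ℂ] K} (h : ∀ x, ‖x‖ ≤ ‖R x‖) :
    ∃ B : H ≃L[ℂ] H, ∀ x, ‖R (B x)‖ = ‖x‖ := by
  have hle : 1 ≤ adjoint R ∘L R := by
    rw [ContinuousLinearMap.le_def, isPositive_def']
    refine ⟨(isPositive_adjoint_comp_self R).isSelfAdjoint.sub (IsSelfAdjoint.one _), fun x => ?_⟩
    have e : (adjoint R ∘L R - 1).reApplyInnerSelf x = ‖R x‖ ^ 2 - ‖x‖ ^ 2 := by
      rw [reApplyInnerSelf_apply, sub_apply, inner_sub_left, comp_apply, adjoint_inner_left]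
      simp [inner_self_eq_norm_sq_to_K, ← Complex.ofReal_pow]
    rw [e, sub_nonneg]
    exact pow_le_pow_left₀ (norm_nonneg _) (h x) 2
  have h0 : 0 ≤ adjoint R ∘L R := zero_le_one.trans hle
  have hu : IsUnit (posSqrt (adjoint R ∘L R)) :=
    (CFC.isUnit_sqrt_iff _ h0).2 (CStarAlgebra.isUnit_of_le 1 hle)
  obtain ⟨s, hs⟩ := hu
  refine ⟨ContinuousLinearEquiv.unitsEquiv ℂ H s⁻¹, fun x => ?_⟩
  set y := ContinuousLinearEquiv.unitsEquiv ℂ H s⁻¹ x with hy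
  have hsy : posSqrt (adjoint R ∘L R) y = x := by
    rw [← hs, hy]
    change ((s : H →L[ℂ] H) * ((s⁻¹ : (H →L[ℂ] H)ˣ) : H →L[ℂ] H)) x = x
    simp
  have e : inner ℂ x x = inner ℂ (R y) (R y) := by
    rw [← hsy, inner_posSqrt_left, ← mul_apply_eq_comp, posSqrt_mul_self h0, comp_apply,
      adjoint_inner_right]
  have := congrArg Complex.re e
  rw [← sq_eq_sq₀ (norm_nonneg _) (norm_nonneg _)]
  simpa [inner_self_eq_norm_sq_to_K, ← Complex.ofReal_pow, eq_comm] using this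

end Operator

/-! ### Pure row contractions -/

section Pure

variable {m : ℕ} {H : Type*} [NormedAddCommGroup H] [InnerProductSpace ℂ H] [CompleteSpace H]

open ContinuousLinearMap

/-- The quadratic form `h ↦ ⟨P^n(I) h, h⟩ = ∑ ‖T_α^* h‖²`, the sum over the words `α` of length `n`. -/
def tailForm (T : Fin m → H →L[ℂ] H) (n : ℕ) (h : H) : ℝ :=
  (inner ℂ (((cpMap T)^[n] (ContinuousLinearMap.id ℂ H)) h) h).re

variable {T : Fin m → H →L[ℂ] H}

theorem tailForm_zero (h : H) : tailForm T 0 h = ‖h‖ ^ 2 := by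
  simp [tailForm, inner_self_eq_norm_sq_to_K, ← Complex.ofReal_pow]

theorem tailForm_succ (n : ℕ) (h : H) :
    tailForm T (n + 1) h = ∑ i, tailForm T n (adjoint (T i) h) := by
  rw [tailForm, Function.iterate_succ_apply', cpMap, sum_apply, sum_inner, Complex.re_sum]
  refine Finset.sum_congr rfl fun i _ => ?_
  rw [comp_apply, comp_apply, ← adjoint_inner_right]
  rfl

theorem tailForm_nonneg (n : ℕ) (h : H) : 0 ≤ tailForm T n h := by
  induction n generalizing h with
  | zero =>
    rw [tailForm_zero]
    positivity
  | succ n ih =>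
    rw [tailForm_succ]
    exact Finset.sum_nonneg fun i _ => ih _

theorem tendsto_tailForm (hT : IsPure T) (h : H) :
    Tendsto (fun n => tailForm T n h) atTop (𝓝 0) := by
  have h1 : Tendsto (fun n => inner ℂ (((cpMap T)^[n] (ContinuousLinearMap.id ℂ H)) h) h) atTop
      (𝓝 (inner ℂ (0 : H) h)) := (hT h).inner tendsto_const_nhds
  rw [inner_zero_left] at h1
  exact (Complex.continuous_re.tendsto 0).comp h1

theorem rowOp_apply {H : Type*} [NormedAddCommGroup H] [InnerProductSpace ℂ H]
    (T : Fin m → H →L[ℂ] H) (x : PiLp 2 (fun _ : Fin m => H)) :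
    rowOp T x = ∑ i, T i (x i) := by
  simp [rowOp, sum_apply]

theorem adjoint_rowOp_apply (T : Fin m → H →L[ℂ] H) (h : H) (i : Fin m) :
    adjoint (rowOp T) h i = adjoint (T i) h := by
  have e : adjoint (rowOp T) h = WithLp.toLp 2 fun i => adjoint (T i) h :=
    ext_inner_left ℂ fun x => by
      rw [adjoint_inner_right, rowOp_apply, sum_inner, PiLp.inner_apply]
      simp [adjoint_inner_right]
  rw [e]

theorem IsRowContraction.norm_rowOp_apply_le {H : Type*} [NormedAddCommGroup H]
    [InnerProductSpace ℂ H] {T : Fin m → H →L[ℂ] H} (hT : IsRowContraction T)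
    (x : PiLp 2 (fun _ : Fin m => H)) : ‖rowOp T x‖ ≤ ‖x‖ := by
  refine le_of_sq_le_sq ?_ (norm_nonneg _)
  rw [rowOp_apply, PiLp.norm_sq_eq_of_L2]
  exact hT _

/-- For a pure tuple `T` and an operator `c` with `c^* c = I - ∑ T_i T_i^*`, the map
`h ↦ ∑ e_α ⊗ c T_α^* h` is an isometry. -/
theorem exists_poissonKernel {G : Type*} [NormedAddCommGroup G] [InnerProductSpace ℂ G]
    (hT : IsPure T) (c : H →L[ℂ] G)
    (hc : ∀ h, ‖c h‖ ^ 2 + ∑ i, ‖adjoint (T i) h‖ ^ 2 = ‖h‖ ^ 2) :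
    ∃ K : H →ₗᵢ[ℂ] Fock m G, (∀ h, K h [] = c h) ∧
      ∀ i h, backward i (K h) = K (adjoint (T i) h) := by
  let p : H × H →ₗ[ℂ] G := (c : H →ₗ[ℂ] G) ∘ₗ LinearMap.snd ℂ H H
  let q (i : Fin m) : H × H →ₗ[ℂ] H := (adjoint (T i) : H →ₗ[ℂ] H) ∘ₗ LinearMap.snd ℂ H H
  have hpq : IsContractiveSystem p q := fun v h => by
    have := hc h
    change ‖c h‖ ^ 2 + ∑ i, ‖adjoint (T i) h‖ ^ 2 ≤ _
    nlinarith [sq_nonneg ‖v‖]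
  have h0 (h : H) : observability hpq h [] = c h := rfl
  have hs (i : Fin m) (h : H) :
      backward i (observability hpq h) = observability hpq (adjoint (T i) h) := rfl
  have hsum (n : ℕ) (h : H) :
      ∑ α ∈ words m n, ‖observability hpq h α‖ ^ 2 + tailForm T n h = ‖h‖ ^ 2 := by
    induction n generalizing h with
    | zero => simp [words, tailForm_zero]
    | succ n ih =>
      rw [sum_words_succ, tailForm_succ, h0, add_assoc, ← Finset.sum_add_distrib, ← hc h]
      congr 1
      exact Finset.sum_congr rfl fun i _ => ih (adjoint (T i) h)
  refine ⟨⟨(observability hpq : H →ₗ[ℂ] Fock m G), fun h => ?_⟩, h0, hs⟩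
  refine le_antisymm (norm_observability_le hpq h) (le_of_sq_le_sq ?_ (norm_nonneg _))
  have hlim := (tendsto_tailForm hT h).const_add (‖observability hpq h‖ ^ 2)
  rw [add_zero] at hlim
  refine ge_of_tendsto' hlim fun n => ?_
  rw [← hsum n h]
  gcongr
  exact sum_words_le_norm_sq _ n

end Pure

/-! ### The characteristic function of a pure row contraction -/

section Characteristic

variable {m : ℕ} {H : Type*} [NormedAddCommGroup H] [InnerProductSpace ℂ H]
variable {E : Type*} [NormedAddCommGroup E] [InnerProductSpace ℂ E]
variable {E' : Type*} [NormedAddCommGroup E'] [InnerProductSpace ℂ E']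

open ContinuousLinearMap

/-- A coisometric module map `V` whose kernel is the range of `Θ` identifies the quotient module with
its target. -/
theorem isCharacteristicOperator_of_coisometry {T : Fin m → H →L[ℂ] H}
    {Θ : Fock m E →L[ℂ] Fock m E'} (hΘ : IsMultiAnalytic Θ) (hΘi : Isometry Θ)
    {V : Fock m E' →L[ℂ] H} {K : H →ₗᵢ[ℂ] Fock m E'} (hVK : ∀ h, V (K h) = h)
    (hV : ∀ f, ‖V f‖ ≤ ‖f‖) (hVT : ∀ i f, V (creation i f) = T i (V f))
    (hker : ∀ f, V f = 0 ↔ ∃ g, Θ g = f) : IsCharacteristicOperator T Θ := by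
  refine ⟨hΘ, hΘi, ?_⟩
  set R := LinearMap.range (Θ : Fock m E →ₗ[ℂ] Fock m E') with hR
  have hRk : R = LinearMap.ker (V : Fock m E' →ₗ[ℂ] H) := by
    ext f
    exact (hker f).symm
  have hsurj : Function.Surjective (V : Fock m E' →ₗ[ℂ] H) := fun h => ⟨K h, hVK h⟩
  let U₀ : (Fock m E' ⧸ R) ≃ₗ[ℂ] H := (Submodule.quotEquivOfEq _ _ hRk).trans
    ((V : Fock m E' →ₗ[ℂ] H).quotKerEquivOfSurjective hsurj)
  have hU₀ (f : Fock m E') : U₀ (Submodule.Quotient.mk f) = V f := rfl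
  have hnorm (f : Fock m E') : ‖V f‖ = ‖(Submodule.Quotient.mk f : Fock m E' ⧸ R)‖ := by
    refine le_antisymm (le_of_forall_pos_le_add fun ε hε => ?_) ?_
    · obtain ⟨g, hg, hlt⟩ :=
        Submodule.Quotient.norm_mk_lt (Submodule.Quotient.mk f : Fock m E' ⧸ R) hε
      have hgf : V f = V g := by rw [← hU₀, ← hg, hU₀]
      rw [hgf]
      exact (hV g).trans hlt.le
    · have : (Submodule.Quotient.mk f : Fock m E' ⧸ R) = Submodule.Quotient.mk (K (V f)) :=
        U₀.injective (by rw [hU₀, hU₀, hVK])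
      rw [this, ← K.norm_map (V f)]
      exact Submodule.Quotient.norm_mk_le R _
  refine ⟨⟨U₀, fun x => ?_⟩, fun i f => ?_⟩
  · obtain ⟨f, rfl⟩ := Submodule.Quotient.mk_surjective R x
    exact hnorm f
  · exact hVT i f

variable [CompleteSpace H] {T : Fin m → H →L[ℂ] H}

theorem norm_adjoint_rowOp_sq (h : H) :
    ‖adjoint (rowOp T) h‖ ^ 2 = ∑ i, ‖adjoint (T i) h‖ ^ 2 := by
  rw [PiLp.norm_sq_eq_of_L2]
  simp only [adjoint_rowOp_apply]

namespace IsRowContraction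

theorem defect_defect (hT : IsRowContraction T) (x : PiLp 2 (fun _ : Fin m => H)) :
    defect T (defect T x) = x - adjoint (rowOp T) (rowOp T x) :=
  posSqrt_posSqrt_apply hT.norm_rowOp_apply_le x

theorem norm_defect_sq (hT : IsRowContraction T) (x : PiLp 2 (fun _ : Fin m => H)) :
    ‖defect T x‖ ^ 2 = ‖x‖ ^ 2 - ‖rowOp T x‖ ^ 2 :=
  norm_posSqrt_apply_sq hT.norm_rowOp_apply_le x

theorem norm_adjoint_le (hT : IsRowContraction T) (h : H) : ‖adjoint (rowOp T) h‖ ≤ ‖h‖ :=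
  norm_adjoint_apply_le hT.norm_rowOp_apply_le h

theorem defectStar_defectStar (hT : IsRowContraction T) (h : H) :
    defectStar T (defectStar T h) = h - rowOp T (adjoint (rowOp T) h) := by
  simpa [defectStar] using posSqrt_posSqrt_apply hT.norm_adjoint_le h

theorem norm_defectStar_sq (hT : IsRowContraction T) (h : H) :
    ‖defectStar T h‖ ^ 2 = ‖h‖ ^ 2 - ∑ i, ‖adjoint (T i) h‖ ^ 2 := by
  rw [← norm_adjoint_rowOp_sq]
  simpa [defectStar] using norm_posSqrt_apply_sq hT.norm_adjoint_le h

theorem one_sub_rowOp_nonneg (hT : IsRowContraction T) :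
    0 ≤ 1 - rowOp T ∘L adjoint (rowOp T) := by
  simpa using one_sub_adjoint_comp_self_nonneg hT.norm_adjoint_le

theorem rowOp_defect (hT : IsRowContraction T) (x : PiLp 2 (fun _ : Fin m => H)) :
    rowOp T (defect T x) = defectStar T (rowOp T x) :=
  DFunLike.congr_fun (comp_posSqrt_eq_posSqrt_comp
    (one_sub_adjoint_comp_self_nonneg hT.norm_rowOp_apply_le) hT.one_sub_rowOp_nonneg
    (by ext; simp)) x

theorem adjoint_defectStar (hT : IsRowContraction T) (h : H) :
    adjoint (rowOp T) (defectStar T h) = defect T (adjoint (rowOp T) h) :=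
  DFunLike.congr_fun (comp_posSqrt_eq_posSqrt_comp (A := adjoint (rowOp T)) hT.one_sub_rowOp_nonneg
    (one_sub_adjoint_comp_self_nonneg hT.norm_rowOp_apply_le)
    (by ext1; simp [comp_apply])) h

theorem rowOp_mem (hT : IsRowContraction T) {x : PiLp 2 (fun _ : Fin m => H)}
    (hx : x ∈ DefectSpace T) : rowOp T x ∈ DefectStarSpace T := by
  refine map_mem_closure (rowOp T).continuous hx ?_
  rintro _ ⟨y, rfl⟩
  exact ⟨rowOp T y, (hT.rowOp_defect y).symm⟩

theorem adjoint_rowOp_mem (hT : IsRowContraction T) {h : H} (hh : h ∈ DefectStarSpace T) :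
    adjoint (rowOp T) h ∈ DefectSpace T := by
  refine map_mem_closure (adjoint (rowOp T)).continuous hh ?_
  rintro _ ⟨k, rfl⟩
  exact ⟨adjoint (rowOp T) k, (hT.adjoint_defectStar k).symm⟩

end IsRowContraction

theorem defect_mem (x : PiLp 2 (fun _ : Fin m => H)) : defect T x ∈ DefectSpace T :=
  Submodule.le_topologicalClosure _ ⟨x, rfl⟩

theorem defectStar_mem (h : H) : defectStar T h ∈ DefectStarSpace T :=
  Submodule.le_topologicalClosure _ ⟨h, rfl⟩

/-- A pure row contraction has a characteristic function `Θ`, and it is a characteristic operator.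
With the Poisson kernel `K`, the symbol of `Θ` is the isometry
`θ x = - 1 ⊗ T x + ∑ i, S_i K (Δ_T x)_i`.  Since the Julia operator of the row `T` is unitary,
`K^* θ = 0`, so that the range of `θ` is wandering; and a vector of `ker K^*` orthogonal to the range
of `Θ` vanishes, coefficient by coefficient. -/
theorem exists_isCharacteristicFunction (hT : IsRowContraction T) (hpure : IsPure T) :
    ∃ Θ : Fock m (DefectSpace T) →L[ℂ] Fock m (DefectStarSpace T),
      IsCharacteristicFunction T Θ ∧ IsCharacteristicOperator T Θ := by
  let c : H →L[ℂ] DefectStarSpace T := (defectStar T).codRestrict _ defectStar_mem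
  obtain ⟨K, hK0, hK⟩ := exists_poissonKernel hpure c fun h => by
    have := hT.norm_defectStar_sq h
    change ‖defectStar T h‖ ^ 2 + _ = _
    linarith
  let V : Fock m (DefectStarSpace T) →L[ℂ] H := adjoint K.toContinuousLinearMap
  have hVin (h : H) (f : Fock m (DefectStarSpace T)) : inner ℂ h (V f) = inner ℂ (K h) f :=
    adjoint_inner_right _ _ _
  have hVS (i : Fin m) (f : Fock m (DefectStarSpace T)) : V (creation i f) = T i (V f) :=
    ext_inner_left ℂ fun h => by
      rw [hVin, ← inner_backward, hK, ← adjoint_inner_left, hVin]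
  have hV1 (y : DefectStarSpace T) : V (vacuum m y) = defectStar T y :=
    ext_inner_left ℂ fun h => by
      rw [hVin, inner_vacuum_right, hK0, defectStar,
        ← inner_posSqrt_left]
      rfl
  have hVK (h : H) : V (K h) = h :=
    ext_inner_left ℂ fun k => by rw [hVin, K.inner_map_map]
  have hVf (f : Fock m (DefectStarSpace T)) :
      V f = defectStar T (f []) + ∑ i, T i (V (backward i f)) := by
    conv_lhs => rw [eq_vacuum_add_sum_creation f]
    simp only [map_add, map_sum, hV1, hVS]
  have hVn (f : Fock m (DefectStarSpace T)) : ‖V f‖ ≤ ‖f‖ :=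
    norm_adjoint_apply_le (A := K.toContinuousLinearMap) (fun h => (K.norm_map h).le) f
  -- The symbol `θ x = - 1 ⊗ T x + ∑ i, S_i K (Δ_T x)_i`.
  let t : DefectSpace T →ₗ[ℂ] DefectStarSpace T :=
    ((rowOp T : PiLp 2 (fun _ : Fin m => H) →ₗ[ℂ] H) ∘ₗ (DefectSpace T).subtype).codRestrict _
      fun x => hT.rowOp_mem x.2
  let θ₀ : DefectSpace T →ₗ[ℂ] Fock m (DefectStarSpace T) :=
    { toFun := fun x => -vacuum m (t x) + ∑ i, creation i (K (defect T x i))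
      map_add' := fun x y => by
        simp only [← vacuumₗᵢ_apply, map_add, Submodule.coe_add, PiLp.add_apply,
          Finset.sum_add_distrib]
        abel
      map_smul' := fun a x => by
        simp only [← vacuumₗᵢ_apply, map_smul, Submodule.coe_smul, PiLp.smul_apply,
          ← Finset.smul_sum, ← smul_neg, ← smul_add, RingHom.id_apply] }
  have hθ₀ (x : DefectSpace T) :
      θ₀ x = -vacuum m (t x) + ∑ i, creation i (K (defect T x i)) := rfl
  have hθ0 (x : DefectSpace T) : θ₀ x [] = - t x := by
    rw [hθ₀, lp.coeFn_add, lp.coeFn_neg, lp.coeFn_sum]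
    simp
  have hθs (x : DefectSpace T) (i : Fin m) : backward i (θ₀ x) = K (defect T x i) := by
    rw [hθ₀]
    simp [backward_creation]
  let θ : DefectSpace T →ₗᵢ[ℂ] Fock m (DefectStarSpace T) := ⟨θ₀, fun x => by
    rw [← sq_eq_sq₀ (norm_nonneg _) (norm_nonneg _), norm_sq_eq_add_sum, hθ0]
    simp only [hθs, K.norm_map, norm_neg]
    rw [← PiLp.norm_sq_eq_of_L2, hT.norm_defect_sq]
    change ‖rowOp T x‖ ^ 2 + _ = ‖(x : PiLp 2 (fun _ : Fin m => H))‖ ^ 2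
    ring⟩
  have hVθ (x : DefectSpace T) : V (θ x) = 0 := by
    rw [hVf]
    change defectStar T (θ₀ x [] : DefectStarSpace T) + ∑ i, T i (V (backward i (θ₀ x))) = 0
    simp only [hθ0, hθs, hVK]
    rw [← rowOp_apply T (defect T x), hT.rowOp_defect, Submodule.coe_neg, map_neg]
    exact neg_add_cancel _
  have hVα (α : List (Fin m)) (f : Fock m (DefectStarSpace T)) :
      V ((α.map creation).prod f) = (α.map T).prod (V f) := by
    induction α with
    | nil => simp
    | cons i α ih => simp [hVS, ih]
  obtain ⟨Θ, hΘ0, hΘ⟩ := isRowIsometry_creation.exists_isometry θ fun x y i α => by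
    rw [← inner_backward]
    change inner ℂ (backward i (θ₀ x)) _ = 0
    rw [hθs, ← hVin, hVα, hVθ, map_zero, inner_zero_right]
  have hΘc (g : Fock m (DefectSpace T)) (k : H) : inner ℂ (Θ g) (K k) = 0 := by
    -- All coefficients of `Θ^* K k` vanish.
    have hadj (α : List (Fin m)) (k : H) : adjoint Θ.toContinuousLinearMap (K k) α = 0 := by
      induction α generalizing k with
      | nil =>
        refine ext_inner_left ℂ fun x => ?_
        rw [← inner_vacuum, adjoint_inner_right, inner_zero_right]
        change inner ℂ (Θ (vacuum m x)) (K k) = 0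
        rw [hΘ0, inner_eq_zero_symm, ← hVin, hVθ, inner_zero_right]
      | cons i α ih =>
        have : backward i (adjoint Θ.toContinuousLinearMap (K k))
            = adjoint Θ.toContinuousLinearMap (K (adjoint (T i) k)) :=
          ext_inner_left ℂ fun g => by
            rw [← inner_creation, adjoint_inner_right, adjoint_inner_right, ← hK, ← inner_creation]
            change inner ℂ (Θ (creation i g)) _ = _
            rw [hΘ]
            rfl
        rw [← backward_apply, this, ih]
    have : adjoint Θ.toContinuousLinearMap (K k) = 0 :=
      lp.ext (funext fun α => hadj α k)
    change inner ℂ (Θ.toContinuousLinearMap g) _ = 0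
    rw [← adjoint_inner_right, this, inner_zero_right]
  have hVΘ (g : Fock m (DefectSpace T)) : V (Θ g) = 0 :=
    ext_inner_left ℂ fun k => by
      rw [hVin, inner_eq_zero_symm.1 (hΘc g k), inner_zero_right]
  -- With `h_i = V S_i^* f`, the two conditions on `f` say that `Δ_{T^*} f_∅ + T h = 0` and
  -- `Δ_T h = T^* f_∅`; the Julia operator being unitary, `h` and `f_∅` vanish.
  have hzero (f : Fock m (DefectStarSpace T)) (hf : V f = 0) (hf' : ∀ g, inner ℂ (Θ g) f = 0) :
      f [] = 0 ∧ ∀ i, V (backward i f) = 0 := by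
    let h : PiLp 2 (fun _ : Fin m => H) := WithLp.toLp 2 fun i => V (backward i f)
    have hh (i : Fin m) : h i = V (backward i f) := rfl
    have e1 : defectStar T (f []) + rowOp T h = 0 := by
      rw [rowOp_apply]
      simp only [hh]
      rw [← hVf, hf]
    have e2 : defect T h = adjoint (rowOp T) (f [] : DefectStarSpace T) := by
      let z : DefectSpace T := ⟨defect T h - adjoint (rowOp T) (f [] : DefectStarSpace T),
        Submodule.sub_mem _ (defect_mem h) (hT.adjoint_rowOp_mem (f []).2)⟩
      have hz (x : DefectSpace T) : inner ℂ x z = 0 := by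
        have e := hf' (vacuum m x)
        rw [hΘ0, inner_eq_add_sum] at e
        change inner ℂ (θ₀ x []) (f []) + ∑ i, inner ℂ (backward i (θ₀ x)) (backward i f) = 0 at e
        simp only [hθ0, hθs, ← hVin, ← hh] at e
        rw [← PiLp.inner_apply, inner_neg_left] at e
        change inner ℂ (x : PiLp 2 (fun _ : Fin m => H))
          (defect T h - adjoint (rowOp T) (f [] : DefectStarSpace T)) = 0
        rw [inner_sub_right, adjoint_inner_right, defect, ← inner_posSqrt_left]
        change -inner ℂ (rowOp T x) (f [] : DefectStarSpace T) + inner ℂ (defect T x) h = 0 at e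
        rw [← e, defect]
        ring
      have : z = 0 := inner_self_eq_zero.1 (hz z)
      exact sub_eq_zero.1 (congrArg Subtype.val this)
    have e3 : h = 0 := by
      have := hT.defect_defect h
      rw [e2, ← hT.adjoint_defectStar, eq_neg_of_add_eq_zero_left e1, map_neg] at this
      exact (sub_eq_neg_self.1 this.symm)
    have e4 : (f [] : H) = 0 := by
      have := hT.defectStar_defectStar (f [] : DefectStarSpace T)
      rw [← e2, eq_neg_of_add_eq_zero_left e1, e3] at this
      simpa using this.symm
    refine ⟨Subtype.ext e4, fun i => ?_⟩
    rw [← hh, e3]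
    rfl
  have hcoeff (α : List (Fin m)) (f : Fock m (DefectStarSpace T)) (hf : V f = 0)
      (hf' : ∀ g, inner ℂ (Θ g) f = 0) : f α = 0 := by
    induction α generalizing f with
    | nil => exact (hzero f hf hf').1
    | cons i α ih =>
      refine ih (backward i f) ((hzero f hf hf').2 i) fun g => ?_
      rw [← inner_creation, ← hΘ, hf']
  have hker (f : Fock m (DefectStarSpace T)) : V f = 0 ↔ ∃ g, Θ g = f := by
    refine ⟨fun hf => ?_, ?_⟩
    · let R := LinearMap.range Θ.toLinearMap
      have hc : IsClosed (R : Set (Fock m (DefectStarSpace T))) :=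
        Θ.isometry.isClosedEmbedding.isClosed_range
      have : CompleteSpace R := hc.completeSpace_coe
      obtain ⟨r, ⟨g, hg⟩, s, hs, hrs⟩ := R.exists_add_mem_mem_orthogonal f
      refine ⟨g, ?_⟩
      have hs0 : s = 0 := by
        refine lp.ext (funext fun α => hcoeff α s ?_ fun g => hs _ ⟨g, rfl⟩)
        have : V f = V (Θ g) + V s := by
          rw [hrs, ← hg, map_add]
          rfl
        rwa [hf, hVΘ, zero_add, eq_comm] at this
      rw [hrs, hs0, add_zero]
      exact hg
    · rintro ⟨g, rfl⟩
      exact hVΘ g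
  have hma : IsMultiAnalytic (Θ.toContinuousLinearMap) := fun i => ext fun f => hΘ i f
  refine ⟨Θ.toContinuousLinearMap, ⟨hma, fun x α => ?_⟩,
    isCharacteristicOperator_of_coisometry hma Θ.isometry hVK hVn hVS hker⟩
  change ((Θ (vacuum m x) α : DefectStarSpace T) : H) = _
  rw [hΘ0]
  change ((θ₀ x α : DefectStarSpace T) : H) = _
  cases α with
  | nil =>
    rw [hθ0]
    rfl
  | cons i α =>
    have hKα (α : List (Fin m)) (k : H) :
        ((K k α : DefectStarSpace T) : H) = defectStar T (wordAdjoint T α k) := by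
      induction α generalizing k with
      | nil =>
        rw [hK0, wordAdjoint, List.map_nil, List.prod_nil]
        change defectStar T k = defectStar T (star (1 : H →L[ℂ] H) k)
        rw [star_one]
        rfl
      | cons j α ih =>
        rw [← backward_apply, hK, ih, wordAdjoint, wordAdjoint, List.map_cons, List.prod_cons]
        change _ = defectStar T (adjoint (T j ∘L (α.map T).prod) k)
        rw [adjoint_comp]
        rfl
    rw [← backward_apply, hθs, hKα]
    rfl

end Characteristic

/-! ### Lifting module maps from a Fock module -/

section Lifting

variable {m : ℕ} {H : Type*} [NormedAddCommGroup H] [InnerProductSpace ℂ H] [CompleteSpace H]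
variable {F : Type*} [NormedAddCommGroup F] [InnerProductSpace ℂ F] [CompleteSpace F]
variable {G : Type*} [NormedAddCommGroup G] [InnerProductSpace ℂ G] [CompleteSpace G]

open ContinuousLinearMap

theorem apply_eq_add_sum_of_intertwining {m : ℕ} {H : Type*}
    [NormedAddCommGroup H] [InnerProductSpace ℂ H] {F : Type*} [NormedAddCommGroup F]
    [InnerProductSpace ℂ F] {T : Fin m → H →L[ℂ] H} {X : Fock m F →L[ℂ] H}
    (hX : ∀ i f, X (creation i f) = T i (X f)) (f : Fock m F) :
    X f = X (vacuum m (f [])) + ∑ i, T i (X (backward i f)) := by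
  conv_lhs => rw [eq_vacuum_add_sum_creation f]
  simp only [map_add, map_sum, hX]

/-- The row operator `[A, B]` on a Hilbert direct sum. -/
def row₂ (A : F →L[ℂ] H) (B : G →L[ℂ] H) : WithLp 2 (F × G) →L[ℂ] H :=
  A ∘L WithLp.fstL 2 ℂ F G + B ∘L WithLp.sndL 2 ℂ F G

theorem norm_adjoint_row₂_sq (A : F →L[ℂ] H) (B : G →L[ℂ] H) (h : H) :
    ‖adjoint (row₂ A B) h‖ ^ 2 = ‖adjoint A h‖ ^ 2 + ‖adjoint B h‖ ^ 2 := by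
  have e : adjoint (row₂ A B) h = WithLp.toLp 2 (adjoint A h, adjoint B h) :=
    ext_inner_left ℂ fun x => by
      rw [adjoint_inner_right, WithLp.prod_inner_apply]
      change inner ℂ (A x.fst + B x.snd) h = _
      rw [inner_add_left]
      simp [adjoint_inner_right]
  rw [e, WithLp.prod_norm_sq_eq_of_L2]
  rfl

/-- The lurking isometry argument: the operators `R = [C, T_1 Γ, …, T_m Γ]` and `Q = [B, Γ]` satisfy
`R R^* = Q Q^*`, so that `Q` factors as `R M` with a contraction `M`, which is a contractive system. -/
theorem exists_contractiveSystem {T : Fin m → H →L[ℂ] H} {C : G →L[ℂ] H} {B : F →L[ℂ] H}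
    {Γ : H →L[ℂ] H} (hΓ : IsSelfAdjoint Γ)
    (hnorm : ∀ h, ‖adjoint B h‖ ^ 2 + ‖Γ h‖ ^ 2
      = ‖adjoint C h‖ ^ 2 + ∑ i, ‖Γ (adjoint (T i) h)‖ ^ 2) :
    ∃ (p : F × H →ₗ[ℂ] G) (q : Fin m → F × H →ₗ[ℂ] H), IsContractiveSystem p q ∧
      ∀ v h, C (p (v, h)) + ∑ i, T i (Γ (q i (v, h))) = B v + Γ h := by
  let R := row₂ C (rowOp fun i => T i ∘L Γ)
  let Q := row₂ B Γ
  obtain ⟨W, hW, hWR⟩ := exists_comp_eq_of_norm_le (R := adjoint R) (Q := adjoint Q) fun h => by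
    refine le_of_eq ((sq_eq_sq₀ (norm_nonneg _) (norm_nonneg _)).1 ?_)
    rw [norm_adjoint_row₂_sq, norm_adjoint_row₂_sq, norm_adjoint_rowOp_sq, hΓ.adjoint_eq, hnorm]
    simp only [adjoint_comp, comp_apply, hΓ.adjoint_eq]
  let M : F × H →ₗ[ℂ] WithLp 2 (G × PiLp 2 (fun _ : Fin m => H)) :=
    (adjoint W : _ →ₗ[ℂ] _) ∘ₗ (WithLp.linearEquiv 2 ℂ (F × H)).symm.toLinearMap
  have hM (v : F) (h : H) : M (v, h) = adjoint W (WithLp.toLp 2 (v, h)) := rfl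
  have hRM (z : WithLp 2 (F × H)) : R (adjoint W z) = Q z := by
    have : R ∘L adjoint W = Q := by
      rw [← adjoint_adjoint Q, ← show W ∘L adjoint R = adjoint Q from ext hWR, adjoint_comp,
        adjoint_adjoint]
    rw [← this, comp_apply]
  refine ⟨WithLp.fstₗ 2 ℂ _ _ ∘ₗ M, fun i =>
    (PiLp.proj 2 (fun _ : Fin m => H) i : _ →L[ℂ] H).toLinearMap ∘ₗ WithLp.sndₗ 2 ℂ _ _ ∘ₗ M,
    fun v h => ?_, fun v h => ?_⟩
  · have h1 := pow_le_pow_left₀ (norm_nonneg _) (norm_adjoint_apply_le hW (WithLp.toLp 2 (v, h))) 2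
    rw [WithLp.prod_norm_sq_eq_of_L2, WithLp.prod_norm_sq_eq_of_L2, PiLp.norm_sq_eq_of_L2] at h1
    exact h1
  · have h1 := hRM (WithLp.toLp 2 (v, h))
    change C _ + rowOp _ _ = B v + Γ h at h1
    rw [rowOp_apply] at h1
    exact h1

/-- For a module map `X` from a Fock module, `X X^* - ∑ T_i X X^* T_i^* = B B^*`, where `B` is the
restriction of `X` to the vacuum space. -/
theorem norm_adjoint_sq_of_intertwining {T : Fin m → H →L[ℂ] H} {X : Fock m F →L[ℂ] H}
    (hX : ∀ i f, X (creation i f) = T i (X f)) (h : H) :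
    ‖adjoint X h‖ ^ 2 = ‖adjoint (X ∘L (vacuumₗᵢ m F).toContinuousLinearMap) h‖ ^ 2
      + ∑ i, ‖adjoint X (adjoint (T i) h)‖ ^ 2 := by
  have h0 : adjoint X h [] = adjoint (X ∘L (vacuumₗᵢ m F).toContinuousLinearMap) h :=
    ext_inner_left ℂ fun x => by
      rw [← inner_vacuum, adjoint_inner_right, adjoint_inner_right]
      rfl
  have hs (i : Fin m) : backward i (adjoint X h) = adjoint X (adjoint (T i) h) :=
    ext_inner_left ℂ fun f => by
      rw [← inner_creation, adjoint_inner_right, adjoint_inner_right, adjoint_inner_right, hX]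
  rw [norm_sq_eq_add_sum, h0]
  simp only [hs]

/-- For a pure tuple, a function with `δ = ∑ T_i δ ∘ q_i` vanishes if it is dominated by a function `N`
that the recursion does not increase.  Iterating the equation and applying the Cauchy-Schwarz
inequality gives `|⟨k, δ z⟩|² ≤ ⟨P^n(I) k, k⟩ N z` for all `n`. -/
theorem eq_zero_of_recursion {T : Fin m → H →L[ℂ] H} (hT : IsPure T) {Z : Type*} {N : Z → ℝ}
    {q : Fin m → Z → Z} (hq : ∀ z, ∑ i, N (q i z) ≤ N z) (hN : ∀ z, 0 ≤ N z) {δ : Z → H}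
    (hδ : ∀ z, ‖δ z‖ ^ 2 ≤ N z) (hrec : ∀ z, δ z = ∑ i, T i (δ (q i z))) (z : Z) : δ z = 0 := by
  have key (n : ℕ) (k : H) (z : Z) : ‖inner ℂ k (δ z)‖ ^ 2 ≤ tailForm T n k * N z := by
    induction n generalizing k z with
    | zero =>
      rw [tailForm_zero]
      refine (pow_le_pow_left₀ (norm_nonneg _) (norm_inner_le_norm k (δ z)) 2).trans ?_
      rw [mul_pow]
      gcongr
      exact hδ z
    | succ n ih =>
      rw [hrec, inner_sum, tailForm_succ]
      calc ‖∑ i, inner ℂ k (T i (δ (q i z)))‖ ^ 2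
          ≤ (∑ i, ‖inner ℂ (adjoint (T i) k) (δ (q i z))‖) ^ 2 := by
            simp only [adjoint_inner_left]
            gcongr
            exact norm_sum_le _ _
        _ ≤ (∑ i, tailForm T n (adjoint (T i) k)) * ∑ i, N (q i z) :=
            Finset.sum_sq_le_sum_mul_sum_of_sq_le_mul _ (fun i _ => tailForm_nonneg n _)
              (fun i _ => hN _) fun i _ => ih _ _
        _ ≤ (∑ i, tailForm T n (adjoint (T i) k)) * N z :=
            mul_le_mul_of_nonneg_left (hq z) (Finset.sum_nonneg fun i _ => tailForm_nonneg n _)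
  refine ext_inner_left ℂ fun k => ?_
  have hlim := (tendsto_tailForm hT k).mul_const (N z)
  rw [zero_mul] at hlim
  have h0 := ge_of_tendsto' hlim fun n => key n k z
  rw [inner_zero_right]
  exact norm_eq_zero.1 (pow_eq_zero_iff two_ne_zero |>.1 (le_antisymm h0 (by positivity)))

/-- Commutant lifting: a contractive module map from a Fock module to a pure module lifts along a
coisometric module map `π` from another Fock module. -/
theorem exists_lift_of_contraction {T : Fin m → H →L[ℂ] H} (hT : IsPure T)
    {π : Fock m G →L[ℂ] H} (hπ : ∀ i f, π (creation i f) = T i (π f))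
    (hπi : ∀ h, ‖adjoint π h‖ = ‖h‖) {X : Fock m F →L[ℂ] H}
    (hX : ∀ i f, X (creation i f) = T i (X f)) (hXc : ∀ f, ‖X f‖ ≤ ‖f‖) :
    ∃ Y : Fock m F →L[ℂ] Fock m G, IsMultiAnalytic Y ∧ ∀ f, π (Y f) = X f := by
  have hXa := norm_adjoint_apply_le hXc
  let Γ := posSqrt (1 - adjoint (adjoint X) ∘L adjoint X)
  have hΓ (h : H) : ‖Γ h‖ ^ 2 = ‖h‖ ^ 2 - ‖adjoint X h‖ ^ 2 := norm_posSqrt_apply_sq hXa h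
  obtain ⟨p, q, hpq, hrel⟩ := exists_contractiveSystem (T := T) (Γ := Γ)
    (C := π ∘L (vacuumₗᵢ m G).toContinuousLinearMap)
    (B := X ∘L (vacuumₗᵢ m F).toContinuousLinearMap) (isSelfAdjoint_posSqrt _)
    fun h => by
      have h1 := norm_adjoint_sq_of_intertwining hπ h
      have h2 := norm_adjoint_sq_of_intertwining hX h
      simp only [hΓ, Finset.sum_sub_distrib]
      simp only [hπi] at h1
      linarith
  -- Started in the state `h`, the response misses the lifting property by `Γ h`.
  have hzero (z : H × Fock m F) : π (response hpq z) - X z.2 - Γ z.1 = 0 := by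
    refine eq_zero_of_recursion hT (N := fun z : H × Fock m F => 9 * (‖z.1‖ ^ 2 + ‖z.2‖ ^ 2))
      (q := fun i z => (q i (z.2 [], z.1), backward i z.2))
      (δ := fun z => π (response hpq z) - X z.2 - Γ z.1) (fun z => ?_)
      (fun z => by positivity) (fun z => ?_) (fun z => ?_) z
    · have h1 := hpq (z.2 []) z.1
      have h2 := norm_sq_eq_add_sum z.2
      rw [← Finset.mul_sum, Finset.sum_add_distrib]
      have := sq_nonneg ‖p (z.2 [], z.1)‖
      linarith
    · set r := √(‖z.1‖ ^ 2 + ‖z.2‖ ^ 2) with hr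
      have hr2 : r ^ 2 = ‖z.1‖ ^ 2 + ‖z.2‖ ^ 2 := Real.sq_sqrt (by positivity)
      have h1 : ‖π (response hpq z)‖ ≤ r := by
        have : ‖π (response hpq z)‖ ≤ ‖response hpq z‖ := by
          simpa using norm_adjoint_apply_le (fun h => (hπi h).le) (response hpq z)
        exact this.trans (Real.le_sqrt_of_sq_le (norm_response_sq_le hpq z.1 z.2))
      have h2 : ‖X z.2‖ ≤ r :=
        (hXc _).trans (Real.le_sqrt_of_sq_le (by nlinarith [sq_nonneg ‖z.1‖]))
      have h3 : ‖Γ z.1‖ ≤ r :=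
        Real.le_sqrt_of_sq_le (by nlinarith [hΓ z.1, sq_nonneg ‖z.2‖, sq_nonneg ‖adjoint X z.1‖])
      have h4 : ‖π (response hpq z) - X z.2 - Γ z.1‖ ≤ 3 * r := by
        refine (norm_sub_le _ _).trans ?_
        have := norm_sub_le (π (response hpq z)) (X z.2)
        linarith
      calc _ ≤ (3 * r) ^ 2 := pow_le_pow_left₀ (norm_nonneg _) h4 2
        _ = _ := by rw [mul_pow, hr2]; norm_num
    · obtain ⟨h, f⟩ := z
      have h1 := apply_eq_add_sum_of_intertwining hπ (response hpq (h, f))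
      have h2 := apply_eq_add_sum_of_intertwining hX f
      have h3 := hrel (f []) h
      simp only [response_nil, backward_response] at h1
      change π (vacuum m (p (f [], h))) + _ = X (vacuum m (f [])) + Γ h at h3
      simp only [map_sub, Finset.sum_sub_distrib]
      rw [h1, h2, eq_sub_of_add_eq h3]
      abel
  refine ⟨transfer hpq, isMultiAnalytic_transfer hpq, fun f => ?_⟩
  rw [transfer_apply]
  simpa [sub_eq_zero] using hzero (0, f)

/-- Commutant lifting without a bound on the norm of the map to be lifted. -/
theorem exists_lift {T : Fin m → H →L[ℂ] H} (hT : IsPure T)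
    {π : Fock m G →L[ℂ] H} (hπ : ∀ i f, π (creation i f) = T i (π f))
    (hπi : ∀ h, ‖adjoint π h‖ = ‖h‖) {X : Fock m F →L[ℂ] H}
    (hX : ∀ i f, X (creation i f) = T i (X f)) :
    ∃ Y : Fock m F →L[ℂ] Fock m G, IsMultiAnalytic Y ∧ ∀ f, π (Y f) = X f := by
  set r : ℂ := ((‖X‖ + 1 : ℝ) : ℂ) with hr
  have hr0 : 0 < ‖X‖ + 1 := by positivity
  have hrn : ‖r‖ = ‖X‖ + 1 := by rw [hr, Complex.norm_real, Real.norm_of_nonneg hr0.le]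
  have hr' : r ≠ 0 := Complex.ofReal_ne_zero.2 hr0.ne'
  obtain ⟨Y, hY, hπY⟩ := exists_lift_of_contraction hT hπ hπi (X := r⁻¹ • X)
    (fun i f => by simp [hX]) fun f => by
      rw [smul_apply, norm_smul, norm_inv, hrn, inv_mul_le_iff₀ hr0]
      refine (X.le_opNorm f).trans ?_
      nlinarith [norm_nonneg f]
  refine ⟨r • Y, fun i => ?_, fun f => ?_⟩
  · rw [smul_comp, hY i, comp_smul]
  · rw [smul_apply, map_smul, hπY, smul_apply, smul_inv_smul₀ hr']

end Lifting

/-! ### Similarity to a Fock module -/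

section Similarity

variable {m : ℕ} {H : Type u} [NormedAddCommGroup H] [InnerProductSpace ℂ H] [CompleteSpace H]
variable {E : Type*} [NormedAddCommGroup E] [InnerProductSpace ℂ E]
variable {E' : Type*} [NormedAddCommGroup E'] [InnerProductSpace ℂ E'] [CompleteSpace E']
variable {T : Fin m → H →L[ℂ] H} {Θ : Fock m E →L[ℂ] Fock m E'} {π : Fock m E' →L[ℂ] H}

open ContinuousLinearMap

/-- The quotient map of the Fock module onto `H` given by a characteristic operator; it is a coisometry,
as its adjoint is isometric. -/
theorem IsCharacteristicOperator.exists_quotientMap (h : IsCharacteristicOperator T Θ) :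
    ∃ π : Fock m E' →L[ℂ] H, (∀ i f, π (creation i f) = T i (π f)) ∧
      (∀ k, ‖adjoint π k‖ = ‖k‖) ∧ ∀ f, π f = 0 ↔ ∃ g, Θ g = f := by
  obtain ⟨-, -, U, hU⟩ := h
  let R := LinearMap.range (Θ : Fock m E →ₗ[ℂ] Fock m E')
  let π : Fock m E' →L[ℂ] H := (U.toLinearEquiv.toLinearMap ∘ₗ R.mkQ).mkContinuous 1 fun f => by
    rw [one_mul]
    exact (U.norm_map _).trans_le (Submodule.Quotient.norm_mk_le R f)
  have hπ (f : Fock m E') : π f = U (Submodule.Quotient.mk f) := rfl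
  have hπ1 (f : Fock m E') : ‖π f‖ ≤ ‖f‖ :=
    (U.norm_map _).trans_le (Submodule.Quotient.norm_mk_le R f)
  refine ⟨π, hU, fun k => le_antisymm (norm_adjoint_apply_le hπ1 k) ?_, fun f => ?_⟩
  · rcases eq_or_ne k 0 with rfl | hk
    · simp
    have hk0 : 0 < ‖k‖ := norm_pos_iff.2 hk
    have hle : ‖k‖ * ‖k‖ ≤ ‖k‖ * ‖adjoint π k‖ := by
      refine le_of_forall_pos_le_add fun ε hε => ?_
      have hε' : 0 < ε / ‖k‖ := div_pos hε hk0
      obtain ⟨f, hf, hlt⟩ := Submodule.Quotient.norm_mk_lt (U.symm k) hε'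
      have hfk : π f = k := by rw [hπ, hf, U.apply_symm_apply]
      rw [U.symm.norm_map] at hlt
      calc ‖k‖ * ‖k‖ = ‖inner ℂ f (adjoint π k)‖ := by
            rw [adjoint_inner_right, hfk, inner_self_eq_norm_sq_to_K]
            simp [sq]
        _ ≤ ‖f‖ * ‖adjoint π k‖ := norm_inner_le_norm _ _
        _ ≤ (‖k‖ + ε / ‖k‖) * ‖adjoint π k‖ := by gcongr
        _ ≤ ‖k‖ * ‖adjoint π k‖ + ε / ‖k‖ * ‖k‖ := by
            rw [add_mul]
            gcongr
            exact norm_adjoint_apply_le hπ1 k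
        _ = _ := by rw [div_mul_cancel₀ _ hk0.ne']
    exact le_of_mul_le_mul_left hle hk0
  · rw [hπ, LinearIsometryEquiv.map_eq_zero_iff, Submodule.Quotient.mk_eq_zero]
    rfl

theorem apply_adjoint_apply_of_norm (hπi : ∀ k, ‖adjoint π k‖ = ‖k‖) (k : H) :
    π (adjoint π k) = k := by
  have := (norm_map_iff_adjoint_comp_self (adjoint π)).1 hπi
  rw [adjoint_adjoint] at this
  exact DFunLike.congr_fun this k

/-- If the quotient by the range of `Θ` is similar to a Fock module, then the quotient map splits by
commutant lifting, which complements the range of `Θ` by a submodule. -/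
theorem hasMultiAnalyticLeftInverse_of_isSimilarToFock {F : Type*} [NormedAddCommGroup F]
    [InnerProductSpace ℂ F] [CompleteSpace F] [CompleteSpace E] (hT : IsPure T)
    (hΘ : IsMultiAnalytic Θ) (hΘi : Isometry Θ) (hπ : ∀ i f, π (creation i f) = T i (π f))
    (hπi : ∀ k, ‖adjoint π k‖ = ‖k‖) (hker : ∀ f, π f = 0 ↔ ∃ g, Θ g = f)
    (h : IsSimilarToFock T F) : HasMultiAnalyticLeftInverse Θ := by
  obtain ⟨X, hX⟩ := h
  obtain ⟨Y, hY, hπY⟩ := exists_lift hT hπ hπi (X := (X : Fock m F →L[ℂ] H)) hX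
  -- `J` is the idempotent module map onto the complement of the range of `Θ`.
  let J : Fock m E' →L[ℂ] Fock m E' := Y ∘L (X.symm : H →L[ℂ] Fock m F) ∘L π
  have hJ (f : Fock m E') : J f = Y (X.symm (π f)) := rfl
  have hJS (i : Fin m) (f : Fock m E') : J (creation i f) = creation i (J f) := by
    have : X.symm (T i (π f)) = creation i (X.symm (π f)) := by
      rw [ContinuousLinearEquiv.symm_apply_eq, hX, X.apply_symm_apply]
    rw [hJ, hπ, this, hJ]
    exact DFunLike.congr_fun (hY i) _
  have hΘn : ∀ g, ‖Θ g‖ = ‖g‖ := fun g => by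
    simpa using hΘi.norm_map_of_map_zero (map_zero Θ) g
  have hΘΘ (g : Fock m E) : adjoint Θ (Θ g) = g :=
    DFunLike.congr_fun ((norm_map_iff_adjoint_comp_self Θ).1 hΘn) g
  let Ψ : Fock m E' →L[ℂ] Fock m E := adjoint Θ ∘L (1 - J)
  have hΨ (f : Fock m E') : Ψ f = adjoint Θ (f - J f) := rfl
  have hΘΨ (f : Fock m E') : Θ (Ψ f) = f - J f := by
    obtain ⟨g, hg⟩ := (hker (f - J f)).1 <| by
      rw [map_sub, hJ, hπY]
      simp
    rw [hΨ, ← hg, hΘΘ]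
  refine ⟨Ψ, fun i => ext fun f => hΘi.injective ?_, ext fun g => ?_⟩
  · have h1 : Θ (creation i (Ψ f)) = creation i (Θ (Ψ f)) := DFunLike.congr_fun (hΘ i) _
    change Θ (Ψ (creation i f)) = Θ (creation i (Ψ f))
    rw [h1, hΘΨ, hΘΨ, hJS, map_sub]
  · change Ψ (Θ g) = g
    rw [hΨ, hJ, (hker (Θ g)).2 ⟨g, rfl⟩]
    simp [hΘΘ]

/-- A left inverse `Ψ` of `Θ` embeds `H` as the submodule `ker Ψ` of the Fock module; renorming `H`
makes the embedding isometric, so that the Wold decomposition applies. -/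
theorem exists_isSimilarToFock_of_leftInverse (hΘ : IsMultiAnalytic Θ)
    (hπ : ∀ i f, π (creation i f) = T i (π f))
    (hπi : ∀ k, ‖adjoint π k‖ = ‖k‖) (hker : ∀ f, π f = 0 ↔ ∃ g, Θ g = f)
    (h : HasMultiAnalyticLeftInverse Θ) :
    ∃ (F : Type u) (_ : NormedAddCommGroup F) (_ : InnerProductSpace ℂ F)
      (_ : CompleteSpace F), IsSimilarToFock T F := by
  obtain ⟨Ψ, hΨ, hΨΘ⟩ := h
  have hπi' := apply_adjoint_apply_of_norm hπi
  let Q : Fock m E' →L[ℂ] Fock m E' := 1 - Θ ∘L Ψ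
  have hQ (f : Fock m E') : Q f = f - Θ (Ψ f) := rfl
  have hQΘ (g : Fock m E) : Q (Θ g) = 0 := by
    rw [hQ, show Ψ (Θ g) = g from DFunLike.congr_fun hΨΘ g, sub_self]
  have hQS (i : Fin m) (f : Fock m E') : Q (creation i f) = creation i (Q f) := by
    rw [hQ, hQ, map_sub, show Ψ (creation i f) = creation i (Ψ f) from DFunLike.congr_fun (hΨ i) f,
      show Θ (creation i (Ψ f)) = creation i (Θ (Ψ f)) from DFunLike.congr_fun (hΘ i) _]
  let ρ : H →L[ℂ] Fock m E' := Q ∘L adjoint π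
  have hρπ (f : Fock m E') : ρ (π f) = Q f := by
    obtain ⟨g, hg⟩ := (hker (f - adjoint π (π f))).1 (by rw [map_sub, hπi', sub_self])
    have := hQΘ g
    rw [hg, map_sub, sub_eq_zero] at this
    exact this.symm
  have hρS (i : Fin m) (k : H) : ρ (T i k) = creation i (ρ k) := by
    rw [← hπi' k, ← hπ, hρπ, hQS, hρπ]
  have hπρ (k : H) : π (ρ k) = k := by
    change π (Q (adjoint π k)) = k
    rw [hQ, map_sub, hπi', (hker _).2 ⟨_, rfl⟩, sub_zero]
  have hπ1 (f : Fock m E') : ‖π f‖ ≤ ‖f‖ := by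
    simpa using norm_adjoint_apply_le (fun k => (hπi k).le) f
  obtain ⟨B, hB⟩ := exists_equiv_norm_comp_eq (R := ρ) fun k => by
    simpa [hπρ] using hπ1 (ρ k)
  let V : H →ₗᵢ[ℂ] Fock m E' := ⟨(ρ ∘L (B : H →L[ℂ] H) : H →ₗ[ℂ] Fock m E'), hB⟩
  let A (i : Fin m) : H →L[ℂ] H := (B.symm : H →L[ℂ] H) ∘L T i ∘L (B : H →L[ℂ] H)
  have hBA (i : Fin m) (k : H) : B (A i k) = T i (B k) := B.apply_symm_apply _
  obtain ⟨F, _, _, _, U, hU⟩ := exists_fock_equiv_of_isometry (A := A) V fun i k => by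
    change ρ (B (A i k)) = creation i (ρ (B k))
    rw [hBA, hρS]
  refine ⟨F, inferInstance, inferInstance, inferInstance, U.toContinuousLinearEquiv.trans B,
    fun i f => ?_⟩
  change B (U (creation i f)) = T i (B (U f))
  rw [hU, hBA]

end Similarity

end FockModule

end

theorem mainTheorem3 {m : ℕ} {H : Type u} [NormedAddCommGroup H] [InnerProductSpace ℂ H]
    [CompleteSpace H] (T : Fin m → H →L[ℂ] H)
    (hT : FockModule.IsRowContraction T) (hpure : FockModule.IsPure T) :
    -- the characteristic function of the row contraction is a characteristic operator of the module
    (∃ Θ : FockModule.Fock m (FockModule.DefectSpace T) →L[ℂ]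
        FockModule.Fock m (FockModule.DefectStarSpace T),
      FockModule.IsCharacteristicFunction T Θ ∧ FockModule.IsCharacteristicOperator T Θ) ∧
    -- and the criterion holds for every characteristic operator of the module
    ∀ (E : Type v) [NormedAddCommGroup E] [InnerProductSpace ℂ E] [CompleteSpace E]
      (E' : Type w) [NormedAddCommGroup E'] [InnerProductSpace ℂ E'] [CompleteSpace E']
      (Θ : FockModule.Fock m E →L[ℂ] FockModule.Fock m E'),
      FockModule.IsCharacteristicOperator T Θ →
        ((∃ (F : Type u) (_ : NormedAddCommGroup F) (_ : InnerProductSpace ℂ F)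
            (_ : CompleteSpace F), FockModule.IsSimilarToFock T F) ↔
          FockModule.HasMultiAnalyticLeftInverse Θ) := by
  refine ⟨FockModule.exists_isCharacteristicFunction hT hpure, fun E _ _ _ E' _ _ _ Θ hΘ => ?_⟩
  obtain ⟨π, hπ, hπi, hker⟩ := hΘ.exists_quotientMap
  constructor
  · rintro ⟨F, _, _, _, hF⟩
    exact FockModule.hasMultiAnalyticLeftInverse_of_isSimilarToFock hpure hΘ.1 hΘ.2.1 hπ hπi hker hF
  · exact FockModule.exists_isSimilarToFock_of_leftInverse hΘ.1 hπ hπi hker
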